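/- **Terms and contexts.** Terms of the linear substitution calculus (LSC) are $t,u ::= x \mid \lambda x.t \mid t\,u \mid t[x{\leftarrow}u]$, taken modulo $\alpha$-equivalence; $\lambda x.t$ and the explicit substitution (ES) $t[x{\leftarrow}u]$ bind $x$ in $t$. Contexts are $C ::= \langle\cdot\rangle \mid \lambda x.C \mid C\,t \mid t\,C \mid C[x{\leftarrow}t] \mid t[x{\leftarrow}C]$, and substitution contexts are $L ::= \langle\cdot\rangle \mid L[x{\leftarrow}t]$. A context is *shallow* if its hole is not inside the argument $u$ of an ES $t[x{\leftarrow}u]$. **Reduction.** The steps at position $C$ are, up to on-the-fly $\alpha$-renaming: multiplicative, $C\langle L\langle\lambda x.t\rangle u\rangle \to_m C\langle L\langle t[x{\leftarrow}u]\rangle\rangle$; exponential, $C\langle x\rangle\to_e C\langle u\rangle$ when $C=C_2\langle C_1[x{\leftarrow}u]\rangle$ and $C_1$ does not capture $x$. Order contexts by $C\prec_{LO}C'$ iff $C\prec_O C'$ or $C\prec_L C'$. Both $\prec_O$ and $\prec_L$ are closed under contexts; $\prec_O$ is generated by $\langle\cdot\rangle\prec_O C$ for $C\neq\langle\cdot\rangle$,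 and $\prec_L$ by $C\,u\prec_L t\,C'$ and $C[x{\leftarrow}u]\prec_L t[x{\leftarrow}C']$ whenever $t=C\langle r\rangle$ and $u=C'\langle r'\rangle$ for some $r,r'$. *Linear leftmost-outermost reduction* $\to_{LO}$ reduces the redex of $t$ whose position is shallow and $\prec_{LO}$-smaller than every other shallow redex position of $t$; each step is an $m$-step or an $e$-step. **Structural equivalence.** $\equiv$ is the least equivalence closed under all contexts such that (with $x\ne y$) $(\lambda x.t)[y{\leftarrow}u]\equiv\lambda x.t[y{\leftarrow}u]$ if $x\notin \mathrm{fv}(u)$; $(t\,u)[x{\leftarrow}w]\equiv t[x{\leftarrow}w]\,u$ if $x\notin \mathrm{fv}(u)$; $(t\,u)[x{\leftarrow}w]\equiv t\,(u[x{\leftarrow}w])$ if $x\notin \mathrm{fv}(t)$; $t[x{\leftarrow}u][y{\leftarrow}w]\equiv t[y{\leftarrow}w][x{\leftarrow}u]$ if $y\notin \mathrm{fv}(u)$ and $x\notin \mathrm{fv}(w)$; $t[x{\leftarrow}u][y{\leftarrow}w]\equiv t[x{\leftarrow}u[y{\leftarrow}w]]$ if $y\notin \mathrm{fv}(t)$;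 $t[x{\leftarrow}u]\equiv_{gc}t$ if $x\notin \mathrm{fv}(t)$; $t[x{\leftarrow}u]\equiv t'[x{\leftarrow}u][y{\leftarrow}u]$, where $t'$ is $t$ with some (possibly no) occurrences of $x$ renamed to a fresh $y$. Write $\to_{gc}^*$ for the reflexive, transitive and contextual closure of the $gc$ rule read from left to right. **The Strong MAM.** Codes are $\lambda$-terms without ES, with names and not modulo $\alpha$. A code is *well-named* if distinct binders bind distinct names and no name is both free and bound. States are tuples $(\varphi,F,t,\pi,E)$: a phase $\varphi\in\{\blacktriangledown,\blacktriangle\}$; a frame $F::=\epsilon\mid(t,\pi):F\mid x:F$; a code $t$; a stack $\pi::=\epsilon\mid t:\pi$; an environment $E::=\epsilon\mid[x{\leftarrow}t]:E\mid\blacktriangledown x:E\mid\blacktriangle x:E$. Initial states are $(\blacktriangledown,\epsilon,t,\epsilon,\epsilon)$ with $t$ closed and well-named. The transitions are: - $c_1$: $(\blacktriangledown,F,t\,u,\pi,E)\to(\blacktriangledown,F,t,u:\pi,E)$; - $m$: $(\blacktriangledown,F,\lambda x.t,u:\pi,E)\to(\blacktriangledown,F,t,\pi,[x{\leftarrow}u]:E)$;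 - $c_2$: $(\blacktriangledown,F,\lambda x.t,\epsilon,E)\to(\blacktriangledown,x:F,t,\epsilon,\blacktriangledown x:E)$; - $e$: $(\blacktriangledown,F,x,\pi,E)\to(\blacktriangledown,F,t^\alpha,\pi,E)$ if $E(x)=t$; - $c_3$: $(\blacktriangledown,F,x,\pi,E)\to(\blacktriangle,F,x,\pi,E)$ if $E(x)=\blacktriangledown$; - $c_4$: $(\blacktriangle,x:F,t,\epsilon,E)\to(\blacktriangle,F,\lambda x.t,\epsilon,\blacktriangle x:E)$; - $c_5$: $(\blacktriangle,(t,\pi):F,u,\epsilon,E)\to(\blacktriangle,F,t\,u,\pi,E)$; - $c_6$: $(\blacktriangle,F,t,u:\pi,E)\to(\blacktriangledown,(t,\pi):F,u,\epsilon,E)$. Here $t^\alpha$ is a well-named $\alpha$-variant of $t$ whose bound names do not occur in the source state; it is chosen by an arbitrary fixed function of the source state and $t$. The look-up $E(x)$ scans $E$ from the left, skipping closed scopes $\blacktriangle y:E_w:\blacktriangledown y$; it returns $t$ at $[x{\leftarrow}t]$, $\blacktriangledown$ at $\blacktriangledown x$, and $\bot$ if neither is met. *Weak* environments are $E_w::=\epsilon\mid[x{\leftarrow}t]:E_w\mid\blacktriangle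 x:E_w:\blacktriangledown x:E_w'$; weak frames $F_w$ contain only pairs; trunk frames $F_t$ (environments $E_t$) are empty or start with some $x$ (with some $\blacktriangledown x$, followed by a well-formed environment, i.e. $E_w:E_t$). Compatibility $F\propto E$ is generated by $\epsilon\propto\epsilon$; by $F_w:F_t\propto E_w:E_t$ if $F_t\propto E_t$; and by $x:F\propto\blacktriangledown x:E$ if $F\propto E$. The transitions $m$ and $e$ are *principal*, the transitions $c_1,\dots,c_6$ are *commutative*; a state is *reachable* if it is reached by transitions from an initial state, and *final* if it has no transition. **Decoding.** Data structures decode to contexts. Stacks: $[\![\epsilon]\!]=\langle\cdot\rangle$ and $[\![u:\pi]\!]=[\![\pi]\!]\langle\langle\cdot\rangle u\rangle$. Weak frames: $[\![\epsilon]\!]=\langle\cdot\rangle$ and $[\![(u,\pi):F_w]\!]=[\![F_w]\!]\langle[\![\pi]\!]\langle u\langle\cdot\rangle\rangle\rangle$. Weak environments: $[\![\epsilon]\!]=\langle\cdot\rangle$, $[\![[x{\leftarrow}u]:E_w]\!]=[\![E_w]\!]\langle\langle\cdot\rangle[x{\leftarrow}u]\rangle$ and $[\![\blacktriangle x:E_w:\blacktriangledown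 x:E_w']\!]=[\![E_w']\!]$. Compatible pairs: $[\![\epsilon\propto\epsilon]\!]=\langle\cdot\rangle$, $[\![F_w:F_t\propto E_w:E_t]\!]=[\![F_t\propto E_t]\!]\langle[\![E_w]\!]\langle[\![F_w]\!]\rangle\rangle$ and $[\![x:F\propto\blacktriangledown x:E]\!]=[\![F\propto E]\!]\langle\lambda x.\langle\cdot\rangle\rangle$. A state $s=(\varphi,F,t,\pi,E)$ has the context $S_s=[\![F\propto E]\!]\langle[\![\pi]\!]\rangle$ and decodes to the term $[\![s]\!]=S_s\langle t\rangle$, taken modulo $\alpha$. **Theorem (Distillation).** (Strong MAM, $\to_{LO}$, $\equiv$, $[\![\cdot]\!]$) is a reflective distillery. That is: 1. The machine is deterministic. Its initial states are in bijection with the closed well-named codes, the initial state of $t$ decodes to $t$ modulo $\alpha$, and every closed $\lambda$-term modulo $\alpha$ is the decoding of an initial state. 2. $\to_{LO}$ is a strategy of the LSC (its $m$- and $e$-steps are $\to_m$- and $\to_e$-steps) and is deterministic, also in the kind of the step. 3. $\equiv$ is an equivalence and a strong bisimulation: if $t\equiv u\to_{LO}w$ then there is $r$ with $t\to_{LO}r\equiv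 w$, and the two steps are of the same kind. 4. For every reachable state $s=(\varphi,F,t,\pi,E)$, $F\propto E$ holds. For every transition $s\to s'$ from a reachable $s$: - if it is $m$, then $[\![s]\!]\to_{LO}u\equiv[\![s']\!]$ for some $u$, by a multiplicative step; - if it is $e$, then $[\![s]\!]\to_{LO}[\![s']\!]$ by an exponential step. The redex has position $S_s$, and the duplicated subterm is the code $E(x)$ (modulo $\alpha$), where the variable $x$ is the code of $s$; - if it is $c_4$, then $[\![s]\!]\to_{gc}^*[\![s']\!]$; - if it is $c_1,c_2,c_3,c_5$ or $c_6$, then $[\![s]\!]=[\![s']\!]$. In particular principal transitions project to $\to_{LO}$ steps of the same kind followed by $\equiv$, and commutative transitions satisfy $[\![s]\!]\equiv[\![s']\!]$. 5. (Reflectiveness) No infinite sequence of commutative transitions starts from a reachable state, and every reachable final state decodes to a $\to_{LO}$-normal form. Consequently the Strong MAM correctly and completely implements $\to_{LO}$. For every initial state $s$: for each execution $s\to^*s'$ there is a derivation $[\![s]\!]\to_{LO}^*u$ with $u\equiv[\![s']\!]$; and for each derivation $[\![s]\!]\to_{LO}^*u$ there is an execution $s\to^*s'$ with $u\equiv[\![s']\!]$.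 In both cases the execution and the derivation have the same number of multiplicative steps and the same number of exponential steps. -/

import Mathlib

/-! # The linear substitution calculus, distilleries and the Strong MAM -/

namespace StrongMAM

/-! ## Terms of the linear substitution calculus, modulo α-equivalence -/

/-- Terms of the linear substitution calculus (LSC), considered up to α-equivalence: they are given
in de Bruijn notation.  `lam t` is `λx.t`, and `es t u` is the explicit substitution `t[x/u]`;
both bind the index `0` in `t` (`es t u` binds nothing in `u`).  Dangling indices are the free
variables. -/
inductive Term : Type
  | var (n : ℕ)
  | lam (t : Term)
  | app (t u : Term)
  | es (t u : Term)

/-- Lifting of a renaming of indices under one binder. -/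
def upRen (f : ℕ → ℕ) : ℕ → ℕ
  | 0 => 0
  | n + 1 => f n + 1

/-- The transposition of the indices `0` and `1`. -/
def swapRen : ℕ → ℕ
  | 0 => 1
  | 1 => 0
  | n + 2 => n + 2

namespace Term

/-- Renaming of the free variables of a term. -/
def rename : (ℕ → ℕ) → Term → Term
  | f, var n => var (f n)
  | f, lam t => lam (rename (upRen f) t)
  | f, app t u => app (rename f t) (rename f u)
  | f, es t u => es (rename (upRen f) t) (rename f u)

/-- `t.shift k` is `t` seen under `k` additional binders that bind none of its free variables. -/
def shift (k : ℕ) (t : Term) : Term := t.rename (fun n => n + k)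

/-- All free variables of the term are among the first `n` indices. -/
def ClosedAt : ℕ → Term → Prop
  | n, var i => i < n
  | n, lam t => ClosedAt (n + 1) t
  | n, app t u => ClosedAt n t ∧ ClosedAt n u
  | n, es t u => ClosedAt (n + 1) t ∧ ClosedAt n u

/-- Closed terms: no free variables. -/
def Closed (t : Term) : Prop := t.ClosedAt 0

/-- Ordinary λ-terms: no explicit substitutions. -/
def Pure : Term → Prop
  | var _ => True
  | lam t => Pure t
  | app t u => Pure t ∧ Pure u
  | es _ _ => False

end Term

/-! ## Contexts -/

/-- General one-hole contexts `⟨·⟩ | λx.C | C t | t C | C[x/t] | t[x/C]`. -/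
inductive Ctx : Type
  | hole
  | lam (C : Ctx)
  | appL (C : Ctx) (t : Term)
  | appR (t : Term) (C : Ctx)
  | esL (C : Ctx) (t : Term)
  | esR (t : Term) (C : Ctx)

namespace Ctx

/-- Plugging `C⟨t⟩` (variables of `t` may be captured by the binders of `C`). -/
def plug : Ctx → Term → Term
  | hole, t => t
  | lam C, t => .lam (C.plug t)
  | appL C u, t => .app (C.plug t) u
  | appR u C, t => .app u (C.plug t)
  | esL C u, t => .es (C.plug t) u
  | esR u C, t => .es u (C.plug t)

/-- Composition of contexts `C⟨D⟩`. -/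
def comp : Ctx → Ctx → Ctx
  | hole, D => D
  | lam C, D => lam (C.comp D)
  | appL C u, D => appL (C.comp D) u
  | appR u C, D => appR u (C.comp D)
  | esL C u, D => esL (C.comp D) u
  | esR u C, D => esR u (C.comp D)

/-- The number of binders of the context whose scope contains the hole. -/
def depth : Ctx → ℕ
  | hole => 0
  | lam C => C.depth + 1
  | appL C _ => C.depth
  | appR _ C => C.depth
  | esL C _ => C.depth + 1
  | esR _ C => C.depth

/-- Substitution contexts `L ::= ⟨·⟩ | L[x/t]`. -/
def IsSubst : Ctx → Prop
  | hole => True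
  | esL C _ => C.IsSubst
  | _ => False

/-- The hole of the context does not lie inside the argument `u` of an explicit substitution
`t[x/u]`. -/
def Shallow : Ctx → Prop
  | hole => True
  | lam C => C.Shallow
  | appL C _ => C.Shallow
  | appR _ C => C.Shallow
  | esL C _ => C.Shallow
  | esR _ _ => False

/-- The prefix relation between contexts and terms: `C⟨u⟩ = t` for some `u`. -/
def IsPrefixOf (C : Ctx) (t : Term) : Prop := ∃ u, C.plug u = t

/-- The outside-in order on contexts. -/
inductive OutsideIn : Ctx → Ctx → Prop
  | root {C : Ctx} : C ≠ hole → OutsideIn hole C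
  | closure (D : Ctx) {C C' : Ctx} : OutsideIn C C' → OutsideIn (D.comp C) (D.comp C')

/-- The left-to-right order on contexts. -/
inductive LeftToRight : Ctx → Ctx → Prop
  | app {C C' : Ctx} {t u : Term} : C.IsPrefixOf t → C'.IsPrefixOf u →
      LeftToRight (appL C u) (appR t C')
  | es {C C' : Ctx} {t u : Term} : C.IsPrefixOf t → C'.IsPrefixOf u →
      LeftToRight (esL C u) (esR t C')
  | closure (D : Ctx) {C C' : Ctx} : LeftToRight C C' → LeftToRight (D.comp C) (D.comp C')

/-- The left-to-right outside-in order on contexts. -/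
def LO (C C' : Ctx) : Prop := C.OutsideIn C' ∨ C.LeftToRight C'

end Ctx

/-! ## Reduction -/

/-- The two kinds of rewriting steps: multiplicative and exponential. -/
inductive Kind : Type
  | m
  | e
  deriving DecidableEq

/-- Multiplicative steps `C⟨L⟨λx.t⟩ u⟩ →m C⟨L⟨t[x/u]⟩⟩`, with the position `C` made explicit.  The
term `u` is shifted because it enters the scope of the binders of `L`. -/
inductive MulAt : Ctx → Term → Term → Prop
  | mk (C L : Ctx) (t u : Term) : L.IsSubst →
      MulAt C (C.plug (.app (L.plug (.lam t)) u)) (C.plug (L.plug (.es t (u.shift L.depth))))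

/-- Exponential steps in compact form: `C⟨x⟩ →e C⟨u⟩` where `C = C₂⟨C₁[x/u]⟩` and `C₁` does not
capture `x`.  `ExpAt C v t t'` says that `t →e t'` at position `C` by replacing the variable
occurrence in the hole of `C` with `v`, the copy of `u` in the scope of the hole of `C`. -/
inductive ExpAt : Ctx → Term → Term → Term → Prop
  | mk (C₂ C₁ : Ctx) (u : Term) :
      ExpAt (C₂.comp (.esL C₁ u)) (u.shift (C₁.depth + 1))
        ((C₂.comp (.esL C₁ u)).plug (.var C₁.depth))
        ((C₂.comp (.esL C₁ u)).plug (u.shift (C₁.depth + 1)))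

/-- Reduction of the redex of position `C`. -/
def RedAt : Kind → Ctx → Term → Term → Prop
  | .m, C, t, t' => MulAt C t t'
  | .e, C, t, t' => ∃ v, ExpAt C v t t'

/-- The reductions `→m` and `→e` of the LSC. -/
def Red (k : Kind) (t t' : Term) : Prop := ∃ C, RedAt k C t t'

/-- `C` is (the position of) a redex of `t` that does not lie inside the argument of an explicit
substitution. -/
def IsShallowRedex (C : Ctx) (t : Term) : Prop := C.Shallow ∧ ∃ k t', RedAt k C t t'

/-- `C` is (the position of) the leftmost-outermost redex of `t`.  Linear leftmost-outermost
reduction does not enter explicit substitutions. -/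
def IsLORedex (C : Ctx) (t : Term) : Prop :=
  IsShallowRedex C t ∧ ∀ C', IsShallowRedex C' t → C' ≠ C → C.LO C'

/-- Linear leftmost-outermost reduction, with the kind of the step. -/
def LOStep (k : Kind) (t t' : Term) : Prop := ∃ C, IsLORedex C t ∧ RedAt k C t t'

/-! ## Structural equivalence -/

/-- Root garbage collection `t[x/u] ≡gc t` if `x ∉ fv t`. -/
inductive GcRoot : Term → Term → Prop
  | mk (t u : Term) : GcRoot (.es (t.shift 1) u) t

/-- The root rules of structural equivalence.  A side condition `x ∉ fv t` is expressed by taking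
`t` in the image of the renaming that skips the index of `x`. -/
inductive StructRoot : Term → Term → Prop
  /-- `(λx.t)[y/u] ≡ λx.t[y/u]` if `x ∉ fv u` -/
  | lam (t u : Term) : StructRoot (.es (.lam t) u) (.lam (.es (t.rename swapRen) (u.shift 1)))
  /-- `(t u)[x/w] ≡ t[x/w] u` if `x ∉ fv u` -/
  | appL (t u w : Term) : StructRoot (.es (.app t (u.shift 1)) w) (.app (.es t w) u)
  /-- `(t u)[x/w] ≡ t u[x/w]` if `x ∉ fv t` -/
  | appR (t u w : Term) : StructRoot (.es (.app (t.shift 1) u) w) (.app t (.es u w))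
  /-- `t[x/u][y/w] ≡ t[y/w][x/u]` if `y ∉ fv u` and `x ∉ fv w` -/
  | com (t u w : Term) :
      StructRoot (.es (.es t (u.shift 1)) w) (.es (.es (t.rename swapRen) (w.shift 1)) u)
  /-- `t[x/u][y/w] ≡ t[x/u[y/w]]` if `y ∉ fv t` -/
  | box (t u w : Term) :
      StructRoot (.es (.es (t.rename (upRen Nat.succ)) u) w) (.es t (.es u w))
  /-- `t[x/u] ≡ t` if `x ∉ fv t` -/
  | gc {t t' : Term} : GcRoot t t' → StructRoot t t'
  /-- `t[x/u] ≡ t'[x/u][y/u]`, where `t'` is obtained from `t` by renaming some (possibly none)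
  occurrences of `x` as a fresh `y`; equivalently, `t` is obtained from `t'` by identifying the
  two variables `x` and `y`. -/
  | dup (t' u : Term) :
      StructRoot (.es (t'.rename Nat.pred) u) (.es (.es t' (u.shift 1)) u)

/-- Closure of a relation under all contexts. -/
def CtxClosure (R : Term → Term → Prop) (a b : Term) : Prop :=
  ∃ (C : Ctx) (t u : Term), R t u ∧ a = C.plug t ∧ b = C.plug u

/-- Structural equivalence: the symmetric, reflexive, transitive and contextual closure of the root
rules. -/
def StructEq : Term → Term → Prop := Relation.EqvGen (CtxClosure StructRoot)

/-- Garbage collection: the reflexive, transitive and contextual closure of the rule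
`t[x/u] ≡gc t`, read from left to right. -/
def GcSteps : Term → Term → Prop := Relation.ReflTransGen (CtxClosure GcRoot)

/-! ## Codes -/

/-- Names of variables. -/
abbrev Name : Type := ℕ

/-- λ-terms without explicit substitutions, with names and not up to α-equivalence. -/
inductive Code : Type
  | var (x : Name)
  | lam (x : Name) (t : Code)
  | app (t u : Code)

/-- The de Bruijn index of the name `x` in the scope of the binders `Γ`, innermost first; a name
that is not in `Γ` is free and becomes the dangling index `Γ.length + x`. -/
def index : List Name → Name → ℕ
  | [], x => x
  | y :: Γ, x => if x = y then 0 else index Γ x + 1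

namespace Code

/-- Free variables. -/
def fv : Code → Finset Name
  | var x => {x}
  | lam x t => t.fv.erase x
  | app t u => t.fv ∪ u.fv

/-- The list of the names bound by the binders of the code. -/
def binders : Code → List Name
  | var _ => []
  | lam x t => x :: t.binders
  | app t u => t.binders ++ u.binders

/-- The names that occur in the code, free, bound or binding. -/
def names (t : Code) : Finset Name := t.fv ∪ t.binders.toFinset

/-- Distinct binders bind distinct names, and no name is both free and bound. -/
def WellNamed (t : Code) : Prop := t.binders.Nodup ∧ ∀ x ∈ t.binders, x ∉ t.fv

/-- The α-equivalence class of a code in the scope of the binders `Γ`. -/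
def toTerm : List Name → Code → Term
  | Γ, var x => .var (index Γ x)
  | Γ, lam x t => .lam (toTerm (x :: Γ) t)
  | Γ, app t u => .app (toTerm Γ t) (toTerm Γ u)

/-- α-equivalence of codes. -/
def AlphaEq (t u : Code) : Prop := t.toTerm [] = u.toTerm []

/-- The codes from which the machine is started: closed and well-named. -/
def IsInitial (t : Code) : Prop := t.fv = ∅ ∧ t.WellNamed

end Code

/-! ## Frames, stacks, environments, states -/

/-- Stacks. -/
abbrev Stack : Type := List Code

/-- Entries of a frame: a pair `(t, π)` of a code and a stack, or a variable. -/
inductive FrameEntry : Type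
  | pair (t : Code) (π : Stack)
  | abs (x : Name)

/-- Frames. -/
abbrev Frame : Type := List FrameEntry

/-- Entries of an environment: a substitution `[x/t]`, or a marker that opens (`▼x`) or closes
(`▲x`) the scope of `x`. -/
inductive EnvEntry : Type
  | sub (x : Name) (t : Code)
  | opening (x : Name)
  | closing (x : Name)

/-- Environments, the most recent entry first. -/
abbrev Env : Type := List EnvEntry

/-- The two phases: evaluation (`▼`) and backtracking (`▲`). -/
inductive Phase : Type
  | eval
  | back

/-- States of the Strong MAM. -/
structure State : Type where
  phase : Phase
  frame : Frame
  code : Code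
  stack : Stack
  env : Env

/-- The names that occur in a stack. -/
def stackNames : Stack → Finset Name
  | [] => ∅
  | t :: π => t.names ∪ stackNames π

/-- The names that occur in a frame. -/
def frameNames : Frame → Finset Name
  | [] => ∅
  | .pair t π :: F => t.names ∪ stackNames π ∪ frameNames F
  | .abs x :: F => {x} ∪ frameNames F

/-- The names that occur in an environment. -/
def envNames : Env → Finset Name
  | [] => ∅
  | .sub x t :: E => {x} ∪ t.names ∪ envNames E
  | .opening x :: E => {x} ∪ envNames E
  | .closing x :: E => {x} ∪ envNames E

/-- The names that occur in a state. -/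
def State.names (s : State) : Finset Name :=
  frameNames s.frame ∪ s.code.names ∪ stackNames s.stack ∪ envNames s.env

/-- Weak environments `Ew ::= ε | [x/t]:Ew | ▲x:Ew:▼x:Ew'`. -/
inductive WeakEnv : Env → Prop
  | nil : WeakEnv []
  | sub (x : Name) (t : Code) {E : Env} : WeakEnv E → WeakEnv (.sub x t :: E)
  | scope (x : Name) {E E' : Env} : WeakEnv E → WeakEnv E' →
      WeakEnv (.closing x :: (E ++ .opening x :: E'))

/-- Well-formed environments: weak environments, and those of the form `Ew:▼x:E` with `Ew` weak and
`E` well-formed. -/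
inductive WellFormedEnv : Env → Prop
  | weak {E : Env} : WeakEnv E → WellFormedEnv E
  | scope (x : Name) {Ew E : Env} : WeakEnv Ew → WellFormedEnv E →
      WellFormedEnv (Ew ++ .opening x :: E)

/-- Trunk environments `Et ::= ε | ▼x:E`. -/
inductive TrunkEnv : Env → Prop
  | nil : TrunkEnv []
  | scope (x : Name) {E : Env} : WellFormedEnv E → TrunkEnv (.opening x :: E)

/-- Weak frames: no variable entry. -/
inductive WeakFrame : Frame → Prop
  | nil : WeakFrame []
  | pair (t : Code) (π : Stack) {F : Frame} : WeakFrame F → WeakFrame (.pair t π :: F)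

/-- Trunk frames `Ft ::= ε | x:F`. -/
inductive TrunkFrame : Frame → Prop
  | nil : TrunkFrame []
  | abs (x : Name) (F : Frame) : TrunkFrame (.abs x :: F)

/-- Compatibility `F ∝ E` between frames and environments. -/
inductive Compatible : Frame → Env → Prop
  | nil : Compatible [] []
  | weak {Fw Ft : Frame} {Ew Et : Env} : WeakFrame Fw → TrunkFrame Ft → WeakEnv Ew → TrunkEnv Et →
      Compatible Ft Et → Compatible (Fw ++ Ft) (Ew ++ Et)
  | abs (x : Name) {F : Frame} {E : Env} : Compatible F E →
      Compatible (.abs x :: F) (.opening x :: E)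

/-- Drops an environment up to and including the first marker that opens a scope. -/
def closeScope : Env → Env
  | [] => []
  | .opening _ :: E => E
  | _ :: E => closeScope E

/-- Removes from an environment all its closed scopes `▲x:Ew:▼x`. -/
def live : Env → Env
  | [] => []
  | .sub x t :: E => .sub x t :: live E
  | .opening x :: E => .opening x :: live E
  | .closing _ :: E => closeScope (live E)

/-- The possible results of looking up a variable: `⊥`, a code, or the mark of an open scope. -/
inductive Binding : Type
  | undefined
  | code (t : Code)
  | opened

/-- Look up in an environment without closed scopes. -/
def lookupLive : Env → Name → Binding
  | [], _ => .undefined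
  | .sub y t :: E, x => if x = y then .code t else lookupLive E x
  | .opening y :: E, x => if x = y then .opened else lookupLive E x
  | .closing _ :: E, x => lookupLive E x

/-- `E(x)`: closed scopes are ignored. -/
def lookup (E : Env) (x : Name) : Binding := lookupLive (live E) x

/-! ## The transitions of the Strong MAM -/

/-- A renaming policy: the code `ρ s t` is the α-renamed copy of `t` that is used by an
exponential transition from the state `s`.  It has to be a well-named α-variant of `t` whose bound
names are fresh, that is, do not occur in `s`. -/
def IsFreshRenaming (ρ : State → Code → Code) : Prop :=
  ∀ s t, (ρ s t).AlphaEq t ∧ (ρ s t).WellNamed ∧ ∀ x ∈ (ρ s t).binders, x ∉ s.names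

/-- The names of the transitions of the Strong MAM. -/
inductive Trans : Type
  | m
  | e
  | c1
  | c2
  | c3
  | c4
  | c5
  | c6

/-- The transitions of the Strong MAM. -/
inductive Step (ρ : State → Code → Code) : Trans → State → State → Prop
  | c1 (F : Frame) (t u : Code) (π : Stack) (E : Env) :
      Step ρ .c1 ⟨.eval, F, .app t u, π, E⟩ ⟨.eval, F, t, u :: π, E⟩
  | m (F : Frame) (x : Name) (t u : Code) (π : Stack) (E : Env) :
      Step ρ .m ⟨.eval, F, .lam x t, u :: π, E⟩ ⟨.eval, F, t, π, .sub x u :: E⟩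
  | c2 (F : Frame) (x : Name) (t : Code) (E : Env) :
      Step ρ .c2 ⟨.eval, F, .lam x t, [], E⟩ ⟨.eval, .abs x :: F, t, [], .opening x :: E⟩
  | e (F : Frame) (x : Name) (t : Code) (π : Stack) (E : Env) : lookup E x = .code t →
      Step ρ .e ⟨.eval, F, .var x, π, E⟩ ⟨.eval, F, ρ ⟨.eval, F, .var x, π, E⟩ t, π, E⟩
  | c3 (F : Frame) (x : Name) (π : Stack) (E : Env) : lookup E x = .opened →
      Step ρ .c3 ⟨.eval, F, .var x, π, E⟩ ⟨.back, F, .var x, π, E⟩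
  | c4 (F : Frame) (x : Name) (t : Code) (E : Env) :
      Step ρ .c4 ⟨.back, .abs x :: F, t, [], E⟩ ⟨.back, F, .lam x t, [], .closing x :: E⟩
  | c5 (F : Frame) (t u : Code) (π : Stack) (E : Env) :
      Step ρ .c5 ⟨.back, .pair t π :: F, u, [], E⟩ ⟨.back, F, .app t u, π, E⟩
  | c6 (F : Frame) (t u : Code) (π : Stack) (E : Env) :
      Step ρ .c6 ⟨.back, F, t, u :: π, E⟩ ⟨.eval, .pair t π :: F, u, [], E⟩

/-! ## The decoding -/

/-- The LSC contexts, with names, into which the data structures of the machine are decoded: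
`⟨·⟩ | λx.C | C t | t C | C[x/t]`. -/
inductive NCtx : Type
  | hole
  | lam (x : Name) (C : NCtx)
  | appL (C : NCtx) (t : Code)
  | appR (t : Code) (C : NCtx)
  | es (C : NCtx) (x : Name) (t : Code)

namespace NCtx

/-- Composition of contexts `C⟨D⟩`. -/
def comp : NCtx → NCtx → NCtx
  | hole, D => D
  | lam x C, D => lam x (C.comp D)
  | appL C t, D => appL (C.comp D) t
  | appR t C, D => appR t (C.comp D)
  | es C x t, D => es (C.comp D) x t

/-- The names bound at the hole of the context, innermost first, when the context itself is in the
scope of the binders `Γ`. -/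
def scope : List Name → NCtx → List Name
  | Γ, hole => Γ
  | Γ, lam x C => scope (x :: Γ) C
  | Γ, appL C _ => scope Γ C
  | Γ, appR _ C => scope Γ C
  | Γ, es C x _ => scope (x :: Γ) C

/-- The de Bruijn form of a context in the scope of the binders `Γ`. -/
def toCtx : List Name → NCtx → Ctx
  | _, hole => .hole
  | Γ, lam x C => .lam (toCtx (x :: Γ) C)
  | Γ, appL C t => .appL (toCtx Γ C) (t.toTerm Γ)
  | Γ, appR t C => .appR (t.toTerm Γ) (toCtx Γ C)
  | Γ, es C x t => .esL (toCtx (x :: Γ) C) (t.toTerm Γ)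

/-- The LSC term, modulo α-equivalence, obtained by plugging a code in a context (free names of the
code may be captured by the binders of the context). -/
def plugCode (C : NCtx) (t : Code) : Term := (C.toCtx []).plug (t.toTerm (C.scope []))

end NCtx

/-- Decoding of stacks. -/
def decodeStack : Stack → NCtx
  | [] => .hole
  | u :: π => (decodeStack π).comp (.appL .hole u)

/-- Decoding of frames paired with environments without closed scopes; the last clause is only
reached by the two empty lists and by pairs that are not compatible. -/
def decodeLive : Frame → Env → NCtx
  | .pair u π :: F, E => (decodeLive F E).comp ((decodeStack π).comp (.appR u .hole))
  | F, .sub x u :: E => (decodeLive F E).comp (.es .hole x u)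
  | .abs x :: F, .opening _ :: E => (decodeLive F E).comp (.lam x .hole)
  | _, _ => .hole
termination_by F E => F.length + E.length

/-- Decoding of compatible pairs. -/
def decodePair (F : Frame) (E : Env) : NCtx := decodeLive F (live E)

/-- The context of a state. -/
def stateCtx (s : State) : NCtx := (decodePair s.frame s.env).comp (decodeStack s.stack)

/-- Decoding of states. -/
def decode (s : State) : Term := (stateCtx s).plugCode s.code

/-! ### The defining equations of look up and decoding on well-formed data -/

/-- Decoding of weak environments. -/
def decodeWeakEnv (E : Env) : NCtx := decodePair [] E

/-- Decoding of weak frames. -/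
def decodeWeakFrame (F : Frame) : NCtx := decodePair F []

theorem closeScope_live_append {E : Env} (h : WeakEnv E) (x : Name) (E' : Env) :
    closeScope (live (E ++ .opening x :: E')) = live E' := by
  induction h generalizing x E' with
  | nil => rfl
  | sub y t _ ih => simpa [live, closeScope] using ih x E'
  | scope y _ _ ih₁ ih₂ => simpa [live, ih₁] using ih₂ x E'

/-- Closed scopes are ignored. -/
theorem live_scope {Ew : Env} (h : WeakEnv Ew) (x : Name) (E : Env) :
    live (.closing x :: (Ew ++ .opening x :: E)) = live E := by
  simpa [live] using closeScope_live_append h x E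

theorem lookup_nil (x : Name) : lookup [] x = .undefined := rfl

theorem lookup_sub (x y : Name) (t : Code) (E : Env) :
    lookup (.sub y t :: E) x = if x = y then .code t else lookup E x := rfl

theorem lookup_opening (x y : Name) (E : Env) :
    lookup (.opening y :: E) x = if x = y then .opened else lookup E x := rfl

theorem lookup_scope {Ew : Env} (h : WeakEnv Ew) (x y : Name) (E : Env) :
    lookup (.closing y :: (Ew ++ .opening y :: E)) x = lookup E x := by
  simp only [lookup, live_scope h]

theorem NCtx.comp_assoc (A B C : NCtx) : (A.comp B).comp C = A.comp (B.comp C) := by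
  induction A with
  | hole => rfl
  | lam x A ih => simp [NCtx.comp, ih]
  | appL A t ih => simp [NCtx.comp, ih]
  | appR t A ih => simp [NCtx.comp, ih]
  | es A x t ih => simp [NCtx.comp, ih]

theorem NCtx.comp_hole (A : NCtx) : A.comp .hole = A := by
  induction A with
  | hole => rfl
  | lam x A ih => simp [NCtx.comp, ih]
  | appL A t ih => simp [NCtx.comp, ih]
  | appR t A ih => simp [NCtx.comp, ih]
  | es A x t ih => simp [NCtx.comp, ih]

theorem decodeWeakEnv_nil : decodeWeakEnv [] = .hole := by
  simp [decodeWeakEnv, decodePair, live, decodeLive]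

theorem decodeWeakEnv_sub (x : Name) (u : Code) (E : Env) :
    decodeWeakEnv (.sub x u :: E) = (decodeWeakEnv E).comp (.es .hole x u) := by
  simp [decodeWeakEnv, decodePair, live, decodeLive]

theorem decodeWeakEnv_scope (x : Name) {E : Env} (h : WeakEnv E) (E' : Env) :
    decodeWeakEnv (.closing x :: (E ++ .opening x :: E')) = decodeWeakEnv E' := by
  simp only [decodeWeakEnv, decodePair, live_scope h]

theorem decodeWeakFrame_nil : decodeWeakFrame [] = .hole := by
  simp [decodeWeakFrame, decodePair, live, decodeLive]

theorem decodeWeakFrame_pair (u : Code) (π : Stack) (F : Frame) :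
    decodeWeakFrame (.pair u π :: F)
      = (decodeWeakFrame F).comp ((decodeStack π).comp (.appR u .hole)) := by
  simp [decodeWeakFrame, decodePair, live, decodeLive]

theorem decodePair_nil : decodePair [] [] = .hole := by
  simp [decodePair, live, decodeLive]

theorem decodePair_abs (x : Name) (F : Frame) (E : Env) :
    decodePair (.abs x :: F) (.opening x :: E) = (decodePair F E).comp (.lam x .hole) := by
  simp [decodePair, live, decodeLive]

theorem decodePair_weakEnv {Ft : Frame} (hF : TrunkFrame Ft) {Ew : Env} (h : WeakEnv Ew)
    (Et : Env) : decodePair Ft (Ew ++ Et) = (decodePair Ft Et).comp (decodeWeakEnv Ew) := by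
  induction h generalizing Et with
  | nil => simp [decodeWeakEnv_nil, NCtx.comp_hole]
  | @sub x u E _ ih =>
    have : decodePair Ft (.sub x u :: (E ++ Et))
        = (decodePair Ft (E ++ Et)).comp (.es .hole x u) := by
      cases hF <;> simp [decodePair, live, decodeLive]
    rw [List.cons_append, this, ih, decodeWeakEnv_sub, NCtx.comp_assoc]
  | @scope x E E' h₁ h₂ ih₁ ih₂ =>
    have : decodePair Ft (.closing x :: (E ++ .opening x :: (E' ++ Et)))
        = decodePair Ft (E' ++ Et) := by
      simp only [decodePair, live_scope h₁]
    rw [List.cons_append, List.append_assoc, List.cons_append, this, ih₂, decodeWeakEnv_scope x h₁]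

theorem decodePair_weak {Fw Ft : Frame} {Ew Et : Env} (hw : WeakFrame Fw) (hF : TrunkFrame Ft)
    (h : WeakEnv Ew) :
    decodePair (Fw ++ Ft) (Ew ++ Et)
      = (decodePair Ft Et).comp ((decodeWeakEnv Ew).comp (decodeWeakFrame Fw)) := by
  induction hw with
  | nil =>
    rw [decodeWeakFrame_nil, NCtx.comp_hole, List.nil_append, decodePair_weakEnv hF h]
  | @pair t π F _ ih =>
    have : decodePair (.pair t π :: (F ++ Ft)) (Ew ++ Et)
        = (decodePair (F ++ Ft) (Ew ++ Et)).comp ((decodeStack π).comp (.appR t .hole)) := by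
      simp [decodePair, decodeLive]
    rw [List.cons_append, this, ih, decodeWeakFrame_pair]
    simp only [NCtx.comp_assoc]

/-! ## Distilleries -/

/-- Labels of the transitions of an abstract machine: principal (multiplicative or exponential) or
commutative. -/
inductive Label : Type
  | principal (k : Kind)
  | commutative
  deriving DecidableEq

/-- `Path R s l s'`: a sequence of transitions of `R` from `s` to `s'`, where `l` lists the
labels. -/
inductive Path {L S : Type} (R : L → S → S → Prop) : S → List L → S → Prop
  | nil (s : S) : Path R s [] s
  | cons {a : L} {l : List L} {s s' s'' : S} : R a s s' → Path R s' l s'' → Path R s (a :: l) s''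

/-- Abstract machines: a labelled transition system with initial states. -/
structure Machine (S : Type) where
  step : Label → S → S → Prop
  initial : Set S

namespace Machine

variable {S : Type} (M : Machine S)

/-- States reachable from the initial states. -/
def Reachable (s : S) : Prop := ∃ s₀ ∈ M.initial, ∃ l, Path M.step s₀ l s

/-- States without outgoing transitions. -/
def Final (s : S) : Prop := ∀ a s', ¬ M.step a s s'

end Machine

/-- Distilleries over the LSC. -/
structure IsDistillery {S : Type} (M : Machine S) (strat : Kind → Term → Term → Prop)
    (eqv : Term → Term → Prop) (decode : S → Term) : Prop where
  machine_deterministic : ∀ a b s s' s'', M.step a s s' → M.step b s s'' → a = b ∧ s' = s''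
  /-- Initial states are in bijection with closed (well-named) codes, each of which is the decoding
  of its initial state modulo α. -/
  initial_bijection : ∃ load : Code → S, Set.BijOn load {t | t.IsInitial} M.initial ∧
    ∀ t, t.IsInitial → decode (load t) = t.toTerm []
  /-- Every closed λ-term, modulo α, is the decoding of an initial state. -/
  initial_complete : ∀ t : Term, t.Pure → t.Closed → ∃ s ∈ M.initial, decode s = t
  strategy_reduction : ∀ k t t', strat k t t' → Red k t t'
  strategy_deterministic : ∀ k k' t t' t'', strat k t t' → strat k' t t'' → k = k' ∧ t' = t''
  equivalence : Equivalence eqv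
  /-- The structural equivalence is a strong bisimulation. -/
  strong_bisimulation : ∀ k t u w, eqv t u → strat k u w → ∃ r, strat k t r ∧ eqv r w
  projection : ∀ k s s', M.Reachable s → M.step (.principal k) s s' →
    ∃ u, strat k (decode s) u ∧ eqv u (decode s')
  distillation : ∀ s s', M.Reachable s → M.step .commutative s s' → eqv (decode s) (decode s')

/-- Reflectiveness: on reachable states, commutative transitions terminate and final states decode
to normal forms of the strategy. -/
structure IsReflective {S : Type} (M : Machine S) (strat : Kind → Term → Term → Prop)
    (decode : S → Term) : Prop where
  termination : ∀ s, M.Reachable s →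
    ¬ ∃ f : ℕ → S, f 0 = s ∧ ∀ n, M.step .commutative (f n) (f (n + 1))
  progress : ∀ s, M.Reachable s → M.Final s → ∀ k u, ¬ strat k (decode s) u

/-- Simulation of the machine by the strategy, up to structural equivalence, with the same number of
multiplicative and of exponential steps. -/
def Simulates {S : Type} (M : Machine S) (strat : Kind → Term → Term → Prop)
    (eqv : Term → Term → Prop) (decode : S → Term) : Prop :=
  ∀ s ∈ M.initial, ∀ l s', Path M.step s l s' →
    ∃ d u, Path strat (decode s) d u ∧ eqv u (decode s') ∧
      ∀ k, l.count (.principal k) = d.count k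

/-- Simulation of the strategy by the machine, up to structural equivalence, with the same number of
multiplicative and of exponential steps. -/
def ReverseSimulates {S : Type} (M : Machine S) (strat : Kind → Term → Term → Prop)
    (eqv : Term → Term → Prop) (decode : S → Term) : Prop :=
  ∀ s ∈ M.initial, ∀ d t, Path strat (decode s) d t →
    ∃ l s', Path M.step s l s' ∧ eqv t (decode s') ∧
      ∀ k, l.count (.principal k) = d.count k

/-- The label of a transition of the Strong MAM. -/
def Trans.label : Trans → Label
  | .m => .principal .m
  | .e => .principal .e
  | _ => .commutative

/-- The Strong MAM as an abstract machine.  Its initial states have the form `(▼, ε, t, ε, ε)` with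
`t` a closed well-named code. -/
def strongMAM (ρ : State → Code → Code) : Machine State where
  step a s s' := ∃ τ : Trans, τ.label = a ∧ Step ρ τ s s'
  initial := {s | ∃ t : Code, t.IsInitial ∧ s = ⟨.eval, [], t, [], []⟩}

end StrongMAM

/-! Linear leftmost-outermost reduction is turned into a partial function. `loStep σ t` searches `t`
for the first redex, while `σ` records what the surrounding explicit substitutions assign to the
free variables, so that an exponential step becomes local to a variable occurrence. `loStep_iff`
identifies this function with `LOStep`, and determinism, also of the kind, is then immediate. The
strong bisimulation becomes a comparison of the values of one function at two equivalent terms: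
every root rule is checked (`loStep_root`), then contexts are added (`StructEq.loStep`). The
delicate rule is `box`, where a step copies `u` on one side and `u[y←w]` on the other;
`loStep_es_push` and `structEq_box_dup` settle it.

For the machine, `State.Inv` records that the codes to the left of the hole in the frame are normal,
are not abstractions and mention only variables of open scopes, that all free names are in scope,
and that the names in scope and those still to be bound are distinct. Hence nothing to the left of
or above the hole reduces, and a redex in the hole is the leftmost-outermost one (`LOAt.stackCtx`,
`LOAt.frameCtx`). A multiplicative transition stores its substitution in the environment, that is,
outside the stack and the topmost pairs of the frame; since its name is fresh, structural
equivalence moves it there (`FrameInv.frameCtx_es`). On leaving an abstraction, the substitutions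
that are dropped bind variables absent from the normal code (`FrameInv.gcSteps`). The other
commutative transitions only redistribute the same term between code and context.

Commutative transitions decrease a weight, and a reachable final state is a normal code with empty
frame and stack. The two simulations hold in any reflective distillery: the bisimulation carries
steps across the equivalence, and termination together with progress forces a principal transition
whenever the decoding can reduce. -/

namespace StrongMAM

/-! ## Renamings -/

theorem upRen_comp (f g : ℕ → ℕ) : upRen g ∘ upRen f = upRen (g ∘ f) := by
  funext n; cases n <;> rfl

theorem upRen_id : upRen id = id := by
  funext n; cases n <;> rfl

namespace Term

theorem rename_rename (t : Term) (f g : ℕ → ℕ) :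
    (t.rename f).rename g = t.rename (g ∘ f) := by
  induction t generalizing f g with
  | var n => rfl
  | lam t ih => simp [rename, ih, upRen_comp]
  | app t u iht ihu => simp [rename, iht, ihu]
  | es t u iht ihu => simp [rename, iht, ihu, upRen_comp]

theorem rename_id (t : Term) : t.rename id = t := by
  induction t with
  | var n => rfl
  | lam t ih => simp [rename, ih, upRen_id]
  | app t u iht ihu => simp [rename, iht, ihu]
  | es t u iht ihu => simp [rename, iht, ihu, upRen_id]

theorem shift_zero (t : Term) : t.shift 0 = t := t.rename_id

theorem shift_shift (t : Term) (i j : ℕ) : (t.shift i).shift j = t.shift (i + j) := by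
  simp only [shift, rename_rename]
  congr 1
  funext n
  simp [Nat.add_assoc]

theorem rename_shift_one (t : Term) (f : ℕ → ℕ) :
    (t.rename f).shift 1 = (t.shift 1).rename (upRen f) := by
  simp only [shift, rename_rename]
  rfl

theorem rename_swap_swap (t : Term) : (t.rename swapRen).rename swapRen = t := by
  rw [rename_rename]
  convert t.rename_id
  funext n
  rcases n with _ | _ | n <;> rfl

/-- Inductions on a weakened term use this at binders: below a binder the unused index is `1`, and
the transposition brings it back to `0`, where the induction hypothesis applies. -/
theorem shift_one_swap (t : Term) :
    (t.shift 1).rename swapRen = t.rename (upRen (· + 1)) := by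
  rw [shift, rename_rename]
  congr 1
  funext n
  rcases n with _ | n <;> rfl

theorem shift_one_shift_one_swap (t : Term) :
    ((t.shift 1).shift 1).rename swapRen = (t.shift 1).shift 1 := by
  simp only [shift, rename_rename]
  rfl

theorem shift_one_pred (t : Term) : (t.shift 1).rename Nat.pred = t := by
  rw [shift, rename_rename]
  exact t.rename_id

end Term

/-! ## Structural equivalence is a congruence -/

theorem Ctx.comp_plug (C D : Ctx) (t : Term) : (C.comp D).plug t = C.plug (D.plug t) := by
  induction C <;> simp_all [Ctx.comp, Ctx.plug]

theorem CtxClosure.plug {R : Term → Term → Prop} {a b : Term} (C : Ctx) (h : CtxClosure R a b) :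
    CtxClosure R (C.plug a) (C.plug b) := by
  obtain ⟨D, t, u, h, rfl, rfl⟩ := h
  exact ⟨C.comp D, t, u, h, (C.comp_plug D t).symm, (C.comp_plug D u).symm⟩

theorem CtxClosure.root {R : Term → Term → Prop} {a b : Term} (h : R a b) : CtxClosure R a b :=
  ⟨.hole, a, b, h, rfl, rfl⟩

/-- Induction on the context of a step of the contextual closure of a relation. -/
theorem CtxClosure.rec_on {R : Term → Term → Prop} {P : Term → Term → Prop}
    (root : ∀ {a b}, R a b → P a b)
    (lam : ∀ {a b}, CtxClosure R a b → P a b → P (.lam a) (.lam b))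
    (appL : ∀ {a b} u, CtxClosure R a b → P a b → P (.app a u) (.app b u))
    (appR : ∀ {a b} u, CtxClosure R a b → P a b → P (.app u a) (.app u b))
    (esL : ∀ {a b} u, CtxClosure R a b → P a b → P (.es a u) (.es b u))
    (esR : ∀ {a b} u, CtxClosure R a b → P a b → P (.es u a) (.es u b))
    {a b : Term} (h : CtxClosure R a b) : P a b := by
  obtain ⟨C, t, u, h, rfl, rfl⟩ := h
  have hc (C : Ctx) := (CtxClosure.root h).plug C
  induction C with
  | hole => exact root h
  | lam C ih => exact lam (hc C) ih
  | appL C w ih => exact appL w (hc C) ih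
  | appR w C ih => exact appR w (hc C) ih
  | esL C w ih => exact esL w (hc C) ih
  | esR w C ih => exact esR w (hc C) ih

namespace StructEq

theorem refl (t : Term) : StructEq t t := Relation.EqvGen.refl t

theorem symm {t u : Term} (h : StructEq t u) : StructEq u t := Relation.EqvGen.symm _ _ h

theorem trans {t u w : Term} (h : StructEq t u) (h' : StructEq u w) : StructEq t w :=
  Relation.EqvGen.trans _ _ _ h h'

theorem of_eq {t u : Term} (h : t = u) : StructEq t u := h ▸ refl t

theorem root {t u : Term} (h : StructRoot t u) : StructEq t u := .rel _ _ (.root h)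

theorem plug (C : Ctx) {t u : Term} (h : StructEq t u) : StructEq (C.plug t) (C.plug u) := by
  induction h with
  | rel _ _ h => exact .rel _ _ (h.plug C)
  | refl _ => exact refl _
  | symm _ _ _ ih => exact ih.symm
  | trans _ _ _ _ _ ih ih' => exact ih.trans ih'

theorem lam {t u : Term} (h : StructEq t u) : StructEq (.lam t) (.lam u) := h.plug (.lam .hole)

theorem app {t t' u u' : Term} (h : StructEq t t') (h' : StructEq u u') :
    StructEq (.app t u) (.app t' u') :=
  (h.plug (.appL .hole u)).trans (h'.plug (.appR t' .hole))

theorem es {t t' u u' : Term} (h : StructEq t t') (h' : StructEq u u') :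
    StructEq (.es t u) (.es t' u') :=
  (h.plug (.esL .hole u)).trans (h'.plug (.esR t' .hole))

theorem gc (t u : Term) : StructEq (.es (t.shift 1) u) t := root (.gc ⟨t, u⟩)

end StructEq

/-- Exponential steps copy terms under binders, hence shift them, so the equivalence has to be
stable under renaming. Side conditions are images of renamings, and each case amounts to commuting
`f` with one of these. -/
theorem StructRoot.rename {t u : Term} (h : StructRoot t u) (f : ℕ → ℕ) :
    StructRoot (t.rename f) (u.rename f) := by
  have hswap (t : Term) : (t.rename swapRen).rename (upRen (upRen f))
      = (t.rename (upRen (upRen f))).rename swapRen := by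
    simp only [Term.rename_rename]
    congr 1
    funext n
    rcases n with _ | _ | n <;> rfl
  cases h with
  | lam t u =>
    simp only [Term.rename, hswap, ← Term.rename_shift_one]
    exact .lam _ _
  | appL t u w =>
    simp only [Term.rename, ← Term.rename_shift_one]
    exact .appL _ _ _
  | appR t u w =>
    simp only [Term.rename, ← Term.rename_shift_one]
    exact .appR _ _ _
  | com t u w =>
    simp only [Term.rename, hswap, ← Term.rename_shift_one]
    exact .com _ _ _
  | box t u w =>
    have : (t.rename (upRen Nat.succ)).rename (upRen (upRen f))
        = (t.rename (upRen f)).rename (upRen Nat.succ) := by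
      simp only [Term.rename_rename, upRen_comp]
      rfl
    simp only [Term.rename, this]
    exact .box _ _ _
  | gc h =>
    obtain ⟨t, u⟩ := h
    simp only [Term.rename, ← Term.rename_shift_one]
    exact .gc ⟨_, _⟩
  | dup t u =>
    have : (t.rename Nat.pred).rename (upRen f)
        = (t.rename (upRen (upRen f))).rename Nat.pred := by
      simp only [Term.rename_rename]
      congr 1
      funext n
      rcases n with _ | _ | n <;> rfl
    simp only [Term.rename, this, ← Term.rename_shift_one]
    exact .dup _ _

theorem StructEq.rename {t u : Term} (h : StructEq t u) (f : ℕ → ℕ) :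
    StructEq (t.rename f) (u.rename f) := by
  induction h with
  | rel _ _ h =>
    revert f
    refine CtxClosure.rec_on (P := fun a b => ∀ f, StructEq (a.rename f) (b.rename f))
      ?_ ?_ ?_ ?_ ?_ ?_ h
    · exact fun h f => root (h.rename f)
    · exact fun _ h f => (h (upRen f)).lam
    · exact fun u _ h f => (h f).app (refl _)
    · exact fun u _ h f => (refl _).app (h f)
    · exact fun u _ h f => (h (upRen f)).es (refl _)
    · exact fun u _ h f => (refl _).es (h f)
  | refl _ => exact refl _
  | symm _ _ _ ih => exact ih.symm
  | trans _ _ _ _ _ ih ih' => exact ih.trans ih'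

/-! ## Linear leftmost-outermost reduction as a partial function -/

/-- The contractum of `t u` if `t` has the form `L⟨λx.s⟩`. -/
def mulRoot : Term → Term → Option Term
  | .lam t, u => some (.es t u)
  | .es t w, u => (mulRoot t (u.shift 1)).map (Term.es · w)
  | _, _ => none

/-- Extension of an assignment of terms to indices to the scope of one more binder. -/
def upEnv (a : Option Term) (σ : ℕ → Option Term) : ℕ → Option Term
  | 0 => a.map (Term.shift 1)
  | n + 1 => (σ n).map (Term.shift 1)

/-- Application of a context to the outcome of a step. -/
def inCtx (f : Term → Term) (o : Option (Kind × Term)) : Option (Kind × Term) :=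
  o.map fun p => (p.1, f p.2)

/-- The linear leftmost-outermost step of a term, where `σ n` is the term that the context of the
term substitutes for the free variable `n`, if any. -/
def loStep : (ℕ → Option Term) → Term → Option (Kind × Term)
  | σ, .var n => (σ n).map fun v => (.e, v)
  | σ, .lam t => inCtx .lam (loStep (upEnv none σ) t)
  | σ, .app t u => ((mulRoot t u).map fun r => (Kind.m, r)).or
      ((inCtx (Term.app · u) (loStep σ t)).or (inCtx (Term.app t) (loStep σ u)))
  | σ, .es t u => inCtx (Term.es · u) (loStep (upEnv (some u) σ) t)

/-- Two assignments correspond to each other along a renaming. -/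
def EnvCompat (f : ℕ → ℕ) (σ σ' : ℕ → Option Term) : Prop :=
  ∀ n, σ' (f n) = (σ n).map (Term.rename f)

theorem EnvCompat.up {f : ℕ → ℕ} {σ σ' : ℕ → Option Term} (h : EnvCompat f σ σ')
    (a : Option Term) : EnvCompat (upRen f) (upEnv a σ) (upEnv (a.map (Term.rename f)) σ') := by
  intro n
  cases n with
  | zero => cases a <;> simp [upEnv, upRen, Term.rename_shift_one]
  | succ n => cases hn : σ n <;> simp [upEnv, upRen, h n, hn, Term.rename_shift_one]

theorem envCompat_shift (a : Option Term) (σ : ℕ → Option Term) :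
    EnvCompat (· + 1) σ (upEnv a σ) := fun _ => rfl

theorem mulRoot_rename (t u : Term) (f : ℕ → ℕ) :
    mulRoot (t.rename f) (u.rename f) = (mulRoot t u).map (Term.rename f) := by
  induction t generalizing u f with
  | var n => rfl
  | lam t _ => rfl
  | app t w _ _ => rfl
  | es t w ih _ =>
    simp only [Term.rename, mulRoot, Term.rename_shift_one, ih, Option.map_map]
    rfl

theorem inCtx_inCtx (f g : Term → Term) (o : Option (Kind × Term)) :
    inCtx f (inCtx g o) = inCtx (f ∘ g) o := by
  cases o <;> rfl

theorem inCtx_or (f : Term → Term) (o o' : Option (Kind × Term)) :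
    inCtx f (o.or o') = (inCtx f o).or (inCtx f o') := by
  cases o <;> rfl

theorem inCtx_map (f : Term → Term) (k : Kind) (o : Option Term) :
    inCtx f (o.map fun r => (k, r)) = (o.map f).map fun r => (k, r) := by
  cases o <;> rfl

/-- The renaming need not be injective: besides shifts and the transposition, it is applied to
`Nat.pred`, which identifies the two variables of the rule `dup`. Compatibility of the assignments
is all that matters. -/
theorem loStep_rename (t : Term) {f : ℕ → ℕ} {σ σ' : ℕ → Option Term} (h : EnvCompat f σ σ') :
    loStep σ' (t.rename f) = inCtx (Term.rename f) (loStep σ t) := by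
  induction t generalizing f σ σ' with
  | var n => simp [Term.rename, loStep, h n, inCtx_map]
  | lam t ih =>
    have := ih (h.up none)
    simp only [Option.map_none] at this
    simp only [Term.rename, loStep, this, inCtx_inCtx]
    rfl
  | app t u iht ihu =>
    simp only [Term.rename, loStep, iht h, ihu h, mulRoot_rename, inCtx_inCtx, inCtx_or, inCtx_map]
    rfl
  | es t u ih _ =>
    have := ih (h.up (some u))
    simp only [Option.map_some] at this
    simp only [Term.rename, loStep, this, inCtx_inCtx]
    rfl

/-! ## Structural equivalence is a strong bisimulation -/

theorem optionRel_map {α β γ δ : Type} {R : γ → δ → Prop} {f : α → γ} {g : β → δ}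
    {a : Option α} {b : Option β} (h : Option.Rel (fun x y => R (f x) (g y)) a b) :
    Option.Rel R (a.map f) (b.map g) := by
  cases h with
  | some h => exact .some h
  | none => exact .none

theorem optionRel_map_left {α β γ : Type} {R : γ → β → Prop} {f : α → γ}
    {a : Option α} {b : Option β} (h : Option.Rel (fun x y => R (f x) y) a b) :
    Option.Rel R (a.map f) b := by
  cases h with
  | some h => exact .some h
  | none => exact .none

theorem optionRel_mono {α β : Type} {R R' : α → β → Prop} (hR : ∀ x y, R x y → R' x y)
    {a : Option α} {b : Option β} (h : Option.Rel R a b) : Option.Rel R' a b := by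
  cases h with
  | some h => exact .some (hR _ _ h)
  | none => exact .none

theorem optionRel_or {α β : Type} {R : α → β → Prop} {a a' : Option α} {b b' : Option β}
    (h : Option.Rel R a b) (h' : Option.Rel R a' b') : Option.Rel R (a.or a') (b.or b') := by
  cases h with
  | some h => exact .some h
  | none => exact h'

theorem optionRel_refl {α : Type} {R : α → α → Prop} (hR : ∀ x, R x x) (a : Option α) :
    Option.Rel R a a := by
  cases a with
  | some a => exact .some (hR a)
  | none => exact .none

/-- Outcomes of the same kind that are related by `R`. -/
abbrev StepRel (R : Term → Term → Prop) : Option (Kind × Term) → Option (Kind × Term) → Prop :=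
  Option.Rel fun p q => p.1 = q.1 ∧ R p.2 q.2

theorem StepRel.inCtx {R R' : Term → Term → Prop} {f g : Term → Term}
    {o o' : Option (Kind × Term)} (h : StepRel R o o') (hR : ∀ a b, R a b → R' (f a) (g b)) :
    StepRel R' (inCtx f o) (inCtx g o') :=
  optionRel_map (optionRel_mono (fun _ _ h => ⟨h.1, hR _ _ h.2⟩) h)

theorem StepRel.inCtx_left {R R' : Term → Term → Prop} {f : Term → Term}
    {o o' : Option (Kind × Term)} (h : StepRel R o o') (hR : ∀ a b, R a b → R' (f a) b) :
    StepRel R' (StrongMAM.inCtx f o) o' := by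
  cases h with
  | some h => exact .some ⟨h.1, hR _ _ h.2⟩
  | none => exact .none

theorem StepRel.inCtx_self {R : Term → Term → Prop} {f g : Term → Term}
    (o : Option (Kind × Term)) (hR : ∀ a, R (f a) (g a)) :
    StepRel R (StrongMAM.inCtx f o) (StrongMAM.inCtx g o) :=
  StepRel.inCtx (R := Eq) (optionRel_refl (fun _ => ⟨rfl, rfl⟩) o) (fun _ _ h => h ▸ hR _)

theorem StepRel.mul {R : Term → Term → Prop} {f : Term → Term} {a b : Option Term}
    (h : Option.Rel (fun x y => R (f x) y) a b) :
    StepRel (fun x y => R (f x) y) (a.map fun r => (Kind.m, r)) (b.map fun r => (Kind.m, r)) :=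
  optionRel_map (optionRel_mono (fun _ _ h => ⟨rfl, h⟩) h)

theorem StepRel.symm {o o' : Option (Kind × Term)} (h : StepRel StructEq o o') :
    StepRel StructEq o' o := by
  cases h with
  | some h => exact .some ⟨h.1.symm, h.2.symm⟩
  | none => exact .none

theorem StepRel.trans {o o' o'' : Option (Kind × Term)} (h : StepRel StructEq o o')
    (h' : StepRel StructEq o' o'') : StepRel StructEq o o'' := by
  cases h with
  | some h => cases h' with
    | some h' => exact .some ⟨h.1.trans h'.1, h.2.trans h'.2⟩
  | none => exact h'

/-! ### Structural equivalence and the values of `mulRoot` and `loStep` -/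

theorem mulRoot_congr_right (t : Term) {u u' : Term} (h : StructEq u u') :
    Option.Rel StructEq (mulRoot t u) (mulRoot t u') := by
  induction t generalizing u u' with
  | var n => exact .none
  | lam t _ => exact .some ((StructEq.refl t).es h)
  | app t w _ _ => exact .none
  | es t w ih _ =>
    exact optionRel_map (optionRel_mono (fun _ _ h => h.es (.refl w)) (ih (h.rename _)))

theorem optionRel_map_self {α β : Type} {R : β → β → Prop} {f g : α → β} (a : Option α)
    (h : ∀ x, R (f x) (g x)) : Option.Rel R (a.map f) (a.map g) :=
  optionRel_map (optionRel_refl h a)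

/-- A substitution moves from the argument of a multiplicative redex to the whole term. -/
theorem mulRoot_es_right (t u w : Term) :
    Option.Rel (fun x y => StructEq (.es x w) y) (mulRoot (t.shift 1) u) (mulRoot t (.es u w)) := by
  induction t generalizing u w with
  | var n => exact .none
  | lam t _ => exact .some (.root (.box t u w))
  | app t v _ _ => exact .none
  | es t v ih _ =>
    -- Under the binder of `[·←v]` the unused variable has index `1`, so the induction hypothesis is
    -- applied after a transposition. The rule `com` then exchanges the substitutions of `v` and
    -- `w`.
    have h1 : mulRoot (t.rename (upRen (· + 1))) (u.shift 1)
        = (mulRoot (t.shift 1) (u.rename (upRen (· + 1)))).map (Term.rename swapRen) := by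
      rw [← mulRoot_rename, Term.shift_one_swap, ← Term.shift_one_swap u,
        Term.rename_swap_swap]
    refine optionRel_map ?_
    change Option.Rel _ (mulRoot (t.rename (upRen (· + 1))) (u.shift 1)) _
    rw [h1]
    refine optionRel_map_left (optionRel_mono ?_ (ih (u.rename (upRen (· + 1))) (w.shift 1)))
    intro x y h
    refine (StructEq.root (.com (x.rename swapRen) v w)).trans ?_
    rw [Term.rename_swap_swap]
    exact h.es (.refl v)

/-- The transposition is an involution, so conjugating `σ` by it always gives a compatible
assignment. -/
theorem loStep_swap (t : Term) (σ : ℕ → Option Term) :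
    loStep σ (t.rename swapRen) = inCtx (Term.rename swapRen)
      (loStep (fun n => (σ (swapRen n)).map (Term.rename swapRen)) t) := by
  apply loStep_rename
  intro n
  beta_reduce
  generalize σ (swapRen n) = a
  cases a <;> simp [Term.rename_swap_swap]

/-- This serves the rule `box`. The variable bound by `[·←w]` does not occur in `t.shift 1`, so it
can enter only through a term copied from `σ`; there the outer substitution accounts for the
difference between `σ` and `σ'`, and everywhere else it can be moved to the copy or garbage
collected. -/
theorem loStep_es_push (t : Term) {w : Term} {σ σ' : ℕ → Option Term}
    (h : ∀ n, Option.Rel (fun a b => StructEq (.es a w) b) (σ (n + 1)) (σ' n)) :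
    StepRel (fun a b => StructEq (.es a w) b) (loStep σ (t.shift 1)) (loStep σ' t) := by
  -- The hypothesis passes a binder once the variable of `w` is transposed back to index `0`. The
  -- term assigned to the new binder does not contain that variable, so `gc` relates its two copies.
  have up {a a' : Option Term} {w : Term} {σ σ' : ℕ → Option Term}
      (ha : a = a'.map (Term.shift 1))
      (h : ∀ n, Option.Rel (fun a b => StructEq (.es a w) b) (σ (n + 1)) (σ' n)) (n : ℕ) :
      Option.Rel (fun a b => StructEq (.es a (w.shift 1)) b)
        ((upEnv a σ (swapRen (n + 1))).map (Term.rename swapRen)) (upEnv a' σ' n) := by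
    cases n with
    | zero =>
      cases a' with
      | none => simp [ha, upEnv, swapRen]
      | some v =>
        simp only [ha, upEnv, swapRen, Option.map_some, Term.shift_one_shift_one_swap]
        exact .some (.gc _ _)
    | succ n =>
      simp only [upEnv, swapRen, Option.map_map]
      refine optionRel_map (optionRel_mono ?_ (h n))
      intro a b h
      have h' := h.rename (· + 1)
      simp only [Function.comp, Term.shift_one_swap]
      exact h'
  induction t generalizing w σ σ' with
  | var n => exact optionRel_map (optionRel_mono (fun a b h => ⟨rfl, h⟩) (h n))
  | lam t ih =>
    change StepRel _ (inCtx _ (loStep _ (t.rename (upRen (· + 1))))) (inCtx _ _)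
    rw [← Term.shift_one_swap, loStep_swap, inCtx_inCtx]
    refine (ih (up (a' := none) rfl h)).inCtx fun a b h => ?_
    refine (StructEq.root (.lam (a.rename swapRen) w)).trans ?_
    rw [Term.rename_swap_swap]
    exact h.lam
  | app t u iht ihu =>
    refine optionRel_or ?_ (optionRel_or ?_ ?_)
    · refine StepRel.mul (R := StructEq) (f := fun a => .es a w) ?_
      change Option.Rel _ (mulRoot (t.shift 1) (u.shift 1)) _
      rw [Term.shift, Term.shift, mulRoot_rename]
      exact optionRel_map_left (optionRel_refl (fun x => .gc x w) _)
    · exact StepRel.inCtx (R' := fun a b => StructEq (.es a w) b) (iht h)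
        fun a b h => (StructEq.root (.appL a u w)).trans (h.app (.refl u))
    · exact StepRel.inCtx (R' := fun a b => StructEq (.es a w) b) (ihu h)
        fun a b h => (StructEq.root (.appR t a w)).trans ((StructEq.refl t).app h)
  | es t u ih _ =>
    change StepRel _ (inCtx _ (loStep _ (t.rename (upRen (· + 1))))) (inCtx _ _)
    rw [← Term.shift_one_swap, loStep_swap, inCtx_inCtx]
    refine (ih (up (a' := some u) rfl h)).inCtx fun a b h => ?_
    refine (StructEq.root (.com (a.rename swapRen) u w)).trans ?_
    rw [Term.rename_swap_swap]
    exact h.es (.refl u)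

/-- Rewriting inside the argument of an explicit substitution leaves the redex in place and changes
only the term that is copied, that is, the assignment. -/
theorem loStep_env_congr (t : Term) {σ σ' : ℕ → Option Term}
    (h : ∀ n, Option.Rel StructEq (σ n) (σ' n)) :
    StepRel StructEq (loStep σ t) (loStep σ' t) := by
  have up {a : Option Term} {σ σ' : ℕ → Option Term} (h : ∀ n, Option.Rel StructEq (σ n) (σ' n))
      (n : ℕ) : Option.Rel StructEq (upEnv a σ n) (upEnv a σ' n) := by
    cases n with
    | zero => exact optionRel_refl .refl _
    | succ n => exact optionRel_map (optionRel_mono (fun _ _ h => h.rename _) (h n))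
  induction t generalizing σ σ' with
  | var n => exact optionRel_map (optionRel_mono (fun a b h => ⟨rfl, h⟩) (h n))
  | lam t ih => exact (ih (up h)).inCtx fun a b h => h.lam
  | app t u iht ihu =>
    refine optionRel_or (optionRel_refl (fun _ => ⟨rfl, .refl _⟩) _) (optionRel_or ?_ ?_)
    · exact (iht h).inCtx fun a b h => h.app (.refl u)
    · exact (ihu h).inCtx fun a b h => (StructEq.refl t).app h
  | es t u ih _ => exact (ih (up h)).inCtx fun a b h => h.es (.refl u)

theorem mulRoot_root {t t' : Term} (h : StructRoot t t') (r : Term) :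
    Option.Rel StructEq (mulRoot t r) (mulRoot t' r) := by
  cases h with
  | lam t u =>
    -- One side contracts to `t[x←r][y←u]`, the other to `t[y←u][x←r]`.
    exact .some (.root (.com t r u))
  | appL t u w => exact .none
  | appR t u w => exact .none
  | com t u w =>
    have h : mulRoot (t.rename swapRen) ((r.shift 1).shift 1)
        = (mulRoot t ((r.shift 1).shift 1)).map (Term.rename swapRen) := by
      rw [← mulRoot_rename, Term.shift_one_shift_one_swap]
    simp only [mulRoot, Option.map_map, h]
    exact optionRel_map_self _ fun x => .root (.com x u w)
  | box t u w =>
    have h : mulRoot (t.rename (upRen Nat.succ)) ((r.shift 1).shift 1)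
        = (mulRoot t (r.shift 1)).map (Term.rename (upRen Nat.succ)) := by
      rw [← mulRoot_rename, ← Term.rename_shift_one]
      rfl
    simp only [mulRoot, Option.map_map, h]
    exact optionRel_map_self _ fun x => .root (.box x u w)
  | gc h =>
    obtain ⟨t, u⟩ := h
    simp only [mulRoot]
    rw [Term.shift, Term.shift, mulRoot_rename, Option.map_map]
    exact optionRel_map_left (optionRel_refl (fun x => .gc x u) _)
  | dup t u =>
    have h : mulRoot (t.rename Nat.pred) (r.shift 1)
        = (mulRoot t ((r.shift 1).shift 1)).map (Term.rename Nat.pred) := by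
      rw [← mulRoot_rename, Term.shift_one_pred]
    simp only [mulRoot, Option.map_map, h]
    exact optionRel_map_self _ fun x => .root (.dup x u)

theorem mulRoot_congr_left {t t' : Term} (h : CtxClosure StructRoot t t') (r : Term) :
    Option.Rel StructEq (mulRoot t r) (mulRoot t' r) := by
  revert r
  refine CtxClosure.rec_on
    (P := fun t t' => ∀ r, Option.Rel StructEq (mulRoot t r) (mulRoot t' r)) ?_ ?_ ?_ ?_ ?_ ?_ h
  · exact fun h r => mulRoot_root h r
  · exact fun h _ r => .some (StructEq.es (.rel _ _ h) (.refl r))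
  · exact fun u _ _ r => .none
  · exact fun u _ _ r => .none
  · exact fun u _ h r => optionRel_map (optionRel_mono (fun _ _ h => h.es (.refl u)) (h _))
  · exact fun {a b} u h _ r => optionRel_map_self _ fun x => (StructEq.refl x).es (.rel _ _ h)

/-- After a copy of `u[y←w]` the term `w` occurs twice on the right and once on the left. Pulling
`[y←w]` out of the argument by `box` and the other substitution of `w` past `[x←u]` by `com` makes
the two adjacent, and `dup` merges them. -/
theorem structEq_box_dup {a b u w : Term} (h : StructEq (.es a (w.shift 1)) b) :
    StructEq (.es (.es (a.rename swapRen) u) w) (.es b (.es u w)) := by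
  refine StructEq.symm ((h.symm.es (.refl _)).trans ?_)
  refine (StructEq.root (.box _ u w)).symm.trans ?_
  have h1 : (Term.es a (w.shift 1)).rename (upRen Nat.succ)
      = .es (a.rename (upRen (upRen Nat.succ))) ((w.shift 1).shift 1) := by
    rw [Term.rename, ← Term.rename_shift_one]
    rfl
  rw [h1]
  refine ((StructEq.root (.com _ (w.shift 1) u)).es (.refl w)).trans ?_
  refine (StructEq.root (.dup _ w)).symm.trans (.of_eq ?_)
  rw [Term.rename, Term.shift_one_pred]
  simp only [Term.rename_rename]
  congr 3
  funext n
  rcases n with _ | _ | n <;> rfl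

theorem loStep_root {t t' : Term} (h : StructRoot t t') (σ : ℕ → Option Term) :
    StepRel StructEq (loStep σ t) (loStep σ t') := by
  -- Two adjacent binders, neither of whose assigned terms uses the other, may be exchanged; this
  -- covers both `lam` and `com`.
  have hswap (a b : Option Term) : EnvCompat swapRen
      (upEnv (a.map (Term.shift 1)) (upEnv b σ)) (upEnv (b.map (Term.shift 1)) (upEnv a σ)) := by
    intro n
    rcases n with _ | _ | n
    · cases a <;> simp [upEnv, swapRen, Term.shift_one_shift_one_swap]
    · cases b <;> simp [upEnv, swapRen, Term.shift_one_shift_one_swap]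
    · cases h : σ n <;> simp [upEnv, swapRen, h, Term.shift_one_shift_one_swap]
  cases h with
  | lam t u =>
    simp only [loStep, inCtx_inCtx]
    have := loStep_rename t (hswap none (some u))
    simp only [Option.map_some, Option.map_none] at this
    rw [this, inCtx_inCtx]
    exact StepRel.inCtx_self _ fun a => .root (.lam a u)
  | appL t u w =>
    have hu := loStep_rename u (envCompat_shift (some w) σ)
    change loStep _ (u.shift 1) = _ at hu
    simp only [loStep, mulRoot, inCtx_or, inCtx_inCtx, inCtx_map, hu]
    refine optionRel_or ?_ (optionRel_or ?_ ?_)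
    · exact optionRel_refl (fun _ => ⟨rfl, .refl _⟩) _
    · exact StepRel.inCtx_self _ fun a => .root (.appL a u w)
    · exact StepRel.inCtx_self _ fun a => .root (.appL t a w)
  | appR t u w =>
    have ht := loStep_rename t (envCompat_shift (some w) σ)
    change loStep _ (t.shift 1) = _ at ht
    simp only [loStep, inCtx_or, inCtx_inCtx, inCtx_map, ht]
    refine optionRel_or ?_ (optionRel_or ?_ ?_)
    · rw [Option.map_map]
      -- The only interaction of the substitution with the redex is at a multiplicative step, where
      -- the argument `u[x←w]` enters a new substitution; this needs `box`.
      exact optionRel_map (optionRel_mono (fun _ _ h => ⟨rfl, h⟩) (mulRoot_es_right t u w))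
    · exact StepRel.inCtx_self _ fun a => .root (.appR a u w)
    · exact StepRel.inCtx_self _ fun a => .root (.appR t a w)
  | com t u w =>
    simp only [loStep, inCtx_inCtx]
    have := loStep_rename t (hswap (some u) (some w))
    simp only [Option.map_some] at this
    rw [this, inCtx_inCtx]
    exact StepRel.inCtx_self _ fun a => .root (.com a u w)
  | box t u w =>
    simp only [loStep, inCtx_inCtx]
    change StepRel _ (inCtx _ (loStep _ (t.rename (upRen (· + 1))))) _
    -- The transposition gives the variable `y` of `[y←w]`, absent from `t`, the index `0` that
    -- `loStep_es_push` expects.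
    rw [← Term.shift_one_swap, loStep_swap, inCtx_inCtx]
    refine (loStep_es_push (w := w.shift 1) (σ' := upEnv (some (.es u w)) σ) t ?_).inCtx
      fun a b h => structEq_box_dup h
    -- Index `0` is `x`, to which the left side assigns `u` and the right side `u[y←w]`; the terms
    -- assigned to the other variables do not contain `y`.
    intro n
    cases n with
    | zero =>
      simp only [upEnv, swapRen, Option.map_some, Term.shift_one_swap]
      exact .some (.refl _)
    | succ n =>
      cases hn : σ n with
      | none => simp [upEnv, swapRen, hn]
      | some v =>
        simp only [upEnv, swapRen, hn, Option.map_some, Term.shift_one_shift_one_swap]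
        exact .some (.gc _ _)
  | gc h =>
    obtain ⟨_, u⟩ := h
    have ht := loStep_rename t' (envCompat_shift (some u) σ)
    change loStep _ (t'.shift 1) = _ at ht
    simp only [loStep, ht, inCtx_inCtx]
    exact StepRel.inCtx_left (R := Eq) (optionRel_refl (fun _ => ⟨rfl, rfl⟩) _)
      fun a b h => h ▸ .gc a u
  | dup t u =>
    -- The two variables that are identified are assigned the same `u`.
    have : EnvCompat Nat.pred (upEnv (some (u.shift 1)) (upEnv (some u) σ))
        (upEnv (some u) σ) := by
      intro n
      rcases n with _ | _ | n
      · simp [upEnv, Term.shift_one_pred]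
      · simp [upEnv, Term.shift_one_pred]
      · cases h : σ n <;> simp [upEnv, h, Term.shift_one_pred]
    have := loStep_rename t this
    simp only [loStep, inCtx_inCtx, this]
    exact StepRel.inCtx_self _ fun a => .root (.dup a u)

/-- Quantifying over `σ` makes the bisimulation provable by induction on the context of a rule,
since entering a binder changes the assignment. -/
theorem StructEq.loStep {t u : Term} (h : StructEq t u) (σ : ℕ → Option Term) :
    StepRel StructEq (loStep σ t) (loStep σ u) := by
  induction h generalizing σ with
  | rel _ _ h =>
    revert σ
    refine CtxClosure.rec_on
      (P := fun t u => ∀ σ, StepRel StructEq (StrongMAM.loStep σ t) (StrongMAM.loStep σ u))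
      ?_ ?_ ?_ ?_ ?_ ?_ h
    · exact fun h σ => loStep_root h σ
    · exact fun _ ih σ => (ih _).inCtx fun _ _ h => h.lam
    · refine fun u h ih σ => optionRel_or ?_ (optionRel_or ?_ ?_)
      · exact optionRel_map (optionRel_mono (fun _ _ h => ⟨rfl, h⟩) (mulRoot_congr_left h u))
      · exact (ih σ).inCtx fun _ _ h => h.app (.refl u)
      · exact StepRel.inCtx_self _ fun a => StructEq.app (.rel _ _ h) (.refl a)
    · refine fun u h ih σ => optionRel_or ?_ (optionRel_or ?_ ?_)
      · exact optionRel_map (optionRel_mono (fun _ _ h => ⟨rfl, h⟩)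
          (mulRoot_congr_right u (.rel _ _ h)))
      · exact StepRel.inCtx_self _ fun a => (StructEq.refl a).app (.rel _ _ h)
      · exact (ih σ).inCtx fun _ _ h => (StructEq.refl u).app h
    · exact fun u _ ih σ => (ih _).inCtx fun _ _ h => h.es (.refl u)
    · refine fun {a b} u h _ σ => (loStep_env_congr u (σ' := upEnv (some b) σ) ?_).inCtx
        fun _ _ h' => h'.es (.rel _ _ h)
      rintro (_ | n)
      · exact .some (StructEq.rename (.rel _ _ h) _)
      · exact optionRel_refl .refl _
  | refl _ => exact optionRel_refl (fun _ => ⟨rfl, .refl _⟩) _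
  | symm _ _ _ ih => exact (ih σ).symm
  | trans _ _ _ _ _ ih ih' => exact (ih σ).trans (ih' σ)

/-! ## The leftmost-outermost redex -/

/-- Shallow redexes, relative to the terms that the context substitutes for free variables. -/
inductive ShallowAt : (ℕ → Option Term) → Kind → Ctx → Term → Term → Prop
  | var {σ n v} : σ n = some v → ShallowAt σ .e .hole (.var n) v
  | mul {σ t u r} : mulRoot t u = some r → ShallowAt σ .m .hole (.app t u) r
  | lam {σ k C t r} : ShallowAt (upEnv none σ) k C t r → ShallowAt σ k (.lam C) (.lam t) (.lam r)
  | appL {σ k C t r u} : ShallowAt σ k C t r → ShallowAt σ k (.appL C u) (.app t u) (.app r u)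
  | appR {σ k C t r u} : ShallowAt σ k C u r → ShallowAt σ k (.appR t C) (.app t u) (.app t r)
  | es {σ k C t r u} : ShallowAt (upEnv (some u) σ) k C t r →
      ShallowAt σ k (.esL C u) (.es t u) (.es r u)

/-- The redex contracted by `loStep`, with its position. -/
inductive LOAt : (ℕ → Option Term) → Kind → Ctx → Term → Term → Prop
  | var {σ n v} : σ n = some v → LOAt σ .e .hole (.var n) v
  | mul {σ t u r} : mulRoot t u = some r → LOAt σ .m .hole (.app t u) r
  | lam {σ k C t r} : LOAt (upEnv none σ) k C t r → LOAt σ k (.lam C) (.lam t) (.lam r)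
  | appL {σ k C t r u} : mulRoot t u = none → LOAt σ k C t r →
      LOAt σ k (.appL C u) (.app t u) (.app r u)
  | appR {σ k C t r u} : mulRoot t u = none → loStep σ t = none → LOAt σ k C u r →
      LOAt σ k (.appR t C) (.app t u) (.app t r)
  | es {σ k C t r u} : LOAt (upEnv (some u) σ) k C t r → LOAt σ k (.esL C u) (.es t u) (.es r u)

theorem LOAt.shallowAt {σ : ℕ → Option Term} {k : Kind} {C : Ctx} {t r : Term}
    (h : LOAt σ k C t r) : ShallowAt σ k C t r := by
  induction h with
  | var h => exact .var h
  | mul h => exact .mul h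
  | lam _ ih => exact .lam ih
  | appL _ _ ih => exact .appL ih
  | appR _ _ _ ih => exact .appR ih
  | es _ ih => exact .es ih

theorem LOAt.loStep {σ : ℕ → Option Term} {k : Kind} {C : Ctx} {t r : Term}
    (h : LOAt σ k C t r) : loStep σ t = some (k, r) := by
  induction h with
  | var h => simp [StrongMAM.loStep, h]
  | mul h => simp [StrongMAM.loStep, h]
  | lam _ ih => simp [StrongMAM.loStep, ih, inCtx]
  | appL h _ ih => simp [StrongMAM.loStep, h, ih, inCtx]
  | appR h h' _ ih => simp [StrongMAM.loStep, h, h', ih, inCtx]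
  | es _ ih => simp [StrongMAM.loStep, ih, inCtx]

theorem exists_loAt {σ : ℕ → Option Term} {k : Kind} {t r : Term} (h : loStep σ t = some (k, r)) :
    ∃ C, LOAt σ k C t r := by
  induction t generalizing σ k r with
  | var n =>
    simp only [loStep, Option.map_eq_some_iff, Prod.mk.injEq] at h
    obtain ⟨v, h, rfl, rfl⟩ := h
    exact ⟨.hole, .var h⟩
  | lam t ih =>
    simp only [loStep, inCtx, Option.map_eq_some_iff, Prod.mk.injEq] at h
    obtain ⟨⟨k, r⟩, h, rfl, rfl⟩ := h
    obtain ⟨C, h⟩ := ih h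
    exact ⟨_, .lam h⟩
  | app t u iht ihu =>
    cases hm : mulRoot t u with
    | some r' =>
      simp only [loStep, hm, Option.map_some, Option.some_or, Option.some.injEq,
        Prod.mk.injEq] at h
      obtain ⟨rfl, rfl⟩ := h
      exact ⟨_, .mul hm⟩
    | none =>
      cases ht : loStep σ t with
      | some p =>
        simp only [loStep, hm, ht, inCtx, Option.map_some, Option.map_none, Option.none_or,
          Option.some_or, Option.some.injEq, Prod.mk.injEq] at h
        obtain ⟨rfl, rfl⟩ := h
        obtain ⟨C, h⟩ := iht ht
        exact ⟨_, .appL hm h⟩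
      | none =>
        simp only [loStep, hm, ht, inCtx, Option.map_none, Option.none_or,
          Option.map_eq_some_iff, Prod.mk.injEq] at h
        obtain ⟨⟨k, r⟩, h, rfl, rfl⟩ := h
        obtain ⟨C, h⟩ := ihu h
        exact ⟨_, .appR hm ht h⟩
  | es t u ih _ =>
    simp only [loStep, inCtx, Option.map_eq_some_iff, Prod.mk.injEq] at h
    obtain ⟨⟨k, r⟩, h, rfl, rfl⟩ := h
    obtain ⟨C, h⟩ := ih h
    exact ⟨_, .es h⟩

theorem ShallowAt.loStep_ne_none {σ : ℕ → Option Term} {k : Kind} {C : Ctx} {t r : Term}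
    (h : ShallowAt σ k C t r) : loStep σ t ≠ none := by
  induction h with
  | var h => simp [loStep, h]
  | mul h => simp [loStep, h]
  | lam _ ih => simpa [loStep, inCtx] using ih
  | appL _ ih => simp [loStep, inCtx, ih]
  | appR _ ih => simp [loStep, inCtx, ih]
  | es _ ih => simpa [loStep, inCtx] using ih

/-- The position determines the redex: its kind is read off the subterm in the hole, a variable or
an application. -/
theorem ShallowAt.unique {σ : ℕ → Option Term} {k k' : Kind} {C : Ctx} {t r r' : Term}
    (h : ShallowAt σ k C t r) (h' : ShallowAt σ k' C t r') : k = k' ∧ r = r' := by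
  induction h generalizing r' with
  | var h =>
    cases h' with
    | var h' => simp_all
  | mul h =>
    cases h' with
    | mul h' => simp_all
  | lam _ ih =>
    cases h' with
    | lam h' => simp [ih h']
  | appL _ ih =>
    cases h' with
    | appL h' => simp [ih h']
  | appR _ ih =>
    cases h' with
    | appR h' => simp [ih h']
  | es _ ih =>
    cases h' with
    | es h' => simp [ih h']

theorem ShallowAt.isPrefixOf {σ : ℕ → Option Term} {k : Kind} {C : Ctx} {t r : Term}
    (h : ShallowAt σ k C t r) : C.IsPrefixOf t := by
  induction h with
  | var | mul => exact ⟨_, rfl⟩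
  | lam _ ih | appL _ ih | appR _ ih | es _ ih =>
    obtain ⟨u, rfl⟩ := ih
    exact ⟨u, rfl⟩

/-! ### Asymmetry of the leftmost-outermost order -/

namespace Ctx

theorem LO.closure (D : Ctx) {C C' : Ctx} (h : C.LO C') : (D.comp C).LO (D.comp C') :=
  h.imp (.closure D) (.closure D)

/-- The shape of the left-to-right outside-in order. -/
def Before : Ctx → Ctx → Prop
  | hole, C' => C' ≠ hole
  | lam C, lam C' => C.Before C'
  | appL C _, appL C' _ => C.Before C'
  | appR _ C, appR _ C' => C.Before C'
  | esL C _, esL C' _ => C.Before C'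
  | esR _ C, esR _ C' => C.Before C'
  | appL _ _, appR _ _ => True
  | esL _ _, esR _ _ => True
  | _, _ => False

theorem Before.asymm {C C' : Ctx} (h : C.Before C') : ¬ C'.Before C := by
  induction C generalizing C' with
  | hole => cases C' <;> simp_all [Before]
  | lam C ih | appL C _ ih | appR _ C ih | esL C _ ih | esR _ C ih =>
    cases C' <;> simp_all [Before]

theorem Before.closure (D : Ctx) {C C' : Ctx} (h : C.Before C') :
    (D.comp C).Before (D.comp C') := by
  induction D <;> simp_all [comp, Before]

/-- The closure rules of `LO` may factor a pair of contexts in many ways, whereas `Before` recurses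
on the two contexts simultaneously, so that asymmetry is a plain induction. -/
theorem LO.before {C C' : Ctx} (h : C.LO C') : C.Before C' := by
  rcases h with h | h
  · induction h with
    | root h => exact h
    | closure D _ ih => exact ih.closure D
  · induction h with
    | app | es => exact trivial
    | closure D _ ih => exact ih.closure D

theorem LO.asymm {C C' : Ctx} (h : C.LO C') : ¬ C'.LO C :=
  fun h' => h.before.asymm h'.before

end Ctx

/-- `LOAt` enters the right of an application only when the application is not a redex and its left
part has no step, and a part without step contains no shallow redex at all. -/
theorem LOAt.lo {σ : ℕ → Option Term} {k k' : Kind} {C C' : Ctx} {t r r' : Term}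
    (h : LOAt σ k C t r) (h' : ShallowAt σ k' C' t r') (hne : C' ≠ C) : C.LO C' := by
  induction h generalizing C' k' r' with
  | var h =>
    cases h' with
    | var h' => exact absurd rfl hne
  | mul h => exact .inl (.root hne)
  | lam _ ih =>
    cases h' with
    | lam h' => exact (ih h' (by simpa using hne)).closure (.lam .hole)
  | @appL _ _ _ _ _ u hm h ih =>
    cases h' with
    | mul h' => simp_all
    | appL h' => exact (ih h' (by simpa using hne)).closure (.appL .hole u)
    | appR h' => exact .inr (.app h.shallowAt.isPrefixOf h'.isPrefixOf)
  | @appR _ _ _ t _ _ hm ht h ih =>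
    cases h' with
    | mul h' => simp_all
    | appL h' => exact absurd ht h'.loStep_ne_none
    | appR h' => exact (ih h' (by simpa using hne)).closure (.appR t .hole)
  | @es _ _ _ _ _ u _ ih =>
    cases h' with
    | es h' => exact (ih h' (by simpa using hne)).closure (.esL .hole u)

/-! ### Shallow redexes are the redexes at shallow positions -/

theorem mulRoot_eq_some {t u r : Term} : mulRoot t u = some r ↔
    ∃ (L : Ctx) (s : Term), L.IsSubst ∧ t = L.plug (.lam s) ∧
      r = L.plug (.es s (u.shift L.depth)) := by
  constructor
  · intro h
    induction t generalizing u r with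
    | var | app => cases h
    | lam t _ =>
      obtain rfl : Term.es t u = r := by simpa [mulRoot] using h
      exact ⟨.hole, t, trivial, rfl, by simp [Ctx.plug, Ctx.depth, Term.shift_zero]⟩
    | es t w ih _ =>
      simp only [mulRoot, Option.map_eq_some_iff] at h
      obtain ⟨r, h, rfl⟩ := h
      obtain ⟨L, s, hL, rfl, rfl⟩ := ih h
      refine ⟨.esL L w, s, hL, rfl, ?_⟩
      simp [Ctx.plug, Ctx.depth, Term.shift_shift, Nat.add_comm]
  · rintro ⟨L, s, hL, rfl, rfl⟩
    induction L generalizing u with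
    | hole => simp [Ctx.plug, Ctx.depth, Term.shift_zero, mulRoot]
    | esL L w ih =>
      simp [Ctx.plug, Ctx.depth, mulRoot, ih hL, Term.shift_shift, Nat.add_comm]
    | lam | appL | appR | esR => cases hL

theorem mulAt_iff {C : Ctx} {t r : Term} : MulAt C t r ↔
    ∃ a u b, mulRoot a u = some b ∧ t = C.plug (.app a u) ∧ r = C.plug b := by
  constructor
  · rintro ⟨L, t, u, hL⟩
    exact ⟨_, _, _, mulRoot_eq_some.2 ⟨L, t, hL, rfl, rfl⟩, rfl, rfl⟩
  · rintro ⟨a, u, b, h, rfl, rfl⟩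
    obtain ⟨L, s, hL, rfl, rfl⟩ := mulRoot_eq_some.1 h
    exact .mk C L s u hL

/-- The terms that a context of shallow position substitutes for the free variables of its hole. -/
def envAt : (ℕ → Option Term) → Ctx → ℕ → Option Term
  | σ, .hole => σ
  | σ, .lam C => envAt (upEnv none σ) C
  | σ, .appL C _ => envAt σ C
  | σ, .appR _ C => envAt σ C
  | σ, .esL C u => envAt (upEnv (some u) σ) C
  | σ, .esR _ C => envAt σ C

/-- An index with a value at the hole either is bound by an explicit substitution of the context,
which splits `C` there, or points outside `C` and gets its value from `σ`. Abstractions of `C`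
assign nothing. -/
theorem envAt_eq_some {σ : ℕ → Option Term} {C : Ctx} (hC : C.Shallow) {n : ℕ} {v : Term} :
    envAt σ C n = some v ↔
      (∃ (C₂ C₁ : Ctx) (u : Term), C = C₂.comp (.esL C₁ u) ∧ n = C₁.depth ∧
        v = u.shift (C₁.depth + 1)) ∨
      (∃ (m : ℕ) (w : Term), n = m + C.depth ∧ σ m = some w ∧ v = w.shift C.depth) := by
  induction C generalizing σ with
  | hole =>
    simp only [envAt, Ctx.depth, Nat.add_zero, Term.shift_zero]
    constructor
    · exact fun h => .inr ⟨n, v, rfl, h, rfl⟩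
    · rintro (⟨C₂, C₁, u, h, -⟩ | ⟨m, w, rfl, h, rfl⟩)
      · cases C₂ <;> simp [Ctx.comp] at h
      · exact h
  | lam C ih =>
    rw [envAt, ih hC]
    constructor
    · rintro (⟨C₂, C₁, u, rfl, rfl, rfl⟩ | ⟨m, w, rfl, h, rfl⟩)
      · exact .inl ⟨.lam C₂, C₁, u, rfl, rfl, rfl⟩
      · rcases m with _ | m
        · simp [upEnv] at h
        · simp only [upEnv, Option.map_eq_some_iff] at h
          obtain ⟨w, h, rfl⟩ := h
          exact .inr ⟨m, w, by simp [Ctx.depth]; omega, h,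
            by simp [Ctx.depth, Term.shift_shift, Nat.add_comm]⟩
    · rintro (⟨C₂, C₁, u, h, rfl, rfl⟩ | ⟨m, w, rfl, h, rfl⟩)
      · cases C₂ <;> simp only [Ctx.comp, Ctx.lam.injEq, reduceCtorEq] at h
        subst h
        exact .inl ⟨_, C₁, u, rfl, rfl, rfl⟩
      · exact .inr ⟨m + 1, w.shift 1, by simp [Ctx.depth]; omega, by simp [upEnv, h],
          by simp [Ctx.depth, Term.shift_shift, Nat.add_comm]⟩
  | appL C t ih =>
    rw [envAt, ih hC]
    refine or_congr ⟨?_, ?_⟩ .rfl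
    · rintro ⟨C₂, C₁, u, rfl, rfl, rfl⟩
      exact ⟨.appL C₂ t, C₁, u, rfl, rfl, rfl⟩
    · rintro ⟨C₂, C₁, u, h, rfl, rfl⟩
      cases C₂ <;> simp only [Ctx.comp, Ctx.appL.injEq, reduceCtorEq] at h
      obtain ⟨rfl, rfl⟩ := h
      exact ⟨_, C₁, u, rfl, rfl, rfl⟩
  | appR t C ih =>
    rw [envAt, ih hC]
    refine or_congr ⟨?_, ?_⟩ .rfl
    · rintro ⟨C₂, C₁, u, rfl, rfl, rfl⟩
      exact ⟨.appR t C₂, C₁, u, rfl, rfl, rfl⟩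
    · rintro ⟨C₂, C₁, u, h, rfl, rfl⟩
      cases C₂ <;> simp only [Ctx.comp, Ctx.appR.injEq, reduceCtorEq] at h
      obtain ⟨rfl, rfl⟩ := h
      exact ⟨_, C₁, u, rfl, rfl, rfl⟩
  | esL C t ih =>
    rw [envAt, ih hC]
    constructor
    · rintro (⟨C₂, C₁, u, rfl, rfl, rfl⟩ | ⟨m, w, rfl, h, rfl⟩)
      · exact .inl ⟨.esL C₂ t, C₁, u, rfl, rfl, rfl⟩
      · rcases m with _ | m
        · obtain rfl : t.shift 1 = w := by simpa [upEnv] using h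
          -- Seen from `C`, index `0` is external; it is the one bound by the explicit substitution
          -- just crossed.
          exact .inl ⟨.hole, C, t, rfl, by simp, by simp [Term.shift_shift, Nat.add_comm]⟩
        · simp only [upEnv, Option.map_eq_some_iff] at h
          obtain ⟨w, h, rfl⟩ := h
          exact .inr ⟨m, w, by simp [Ctx.depth]; omega, h,
            by simp [Ctx.depth, Term.shift_shift, Nat.add_comm]⟩
    · rintro (⟨C₂, C₁, u, h, rfl, rfl⟩ | ⟨m, w, rfl, h, rfl⟩)
      · cases C₂ <;> simp only [Ctx.comp, Ctx.esL.injEq, reduceCtorEq] at h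
        · obtain ⟨rfl, rfl⟩ := h
          exact .inr ⟨0, t.shift 1, by simp, rfl, by simp [Term.shift_shift, Nat.add_comm]⟩
        · obtain ⟨rfl, rfl⟩ := h
          exact .inl ⟨_, C₁, u, rfl, rfl, rfl⟩
      · exact .inr ⟨m + 1, w.shift 1, by simp [Ctx.depth]; omega, by simp [upEnv, h],
          by simp [Ctx.depth, Term.shift_shift, Nat.add_comm]⟩
  | esR => cases hC

theorem exists_expAt_iff {C : Ctx} (hC : C.Shallow) {t r : Term} : (∃ v, ExpAt C v t r) ↔
    ∃ n v, envAt (fun _ => none) C n = some v ∧ t = C.plug (.var n) ∧ r = C.plug v := by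
  constructor
  · rintro ⟨v, C₂, C₁, u⟩
    exact ⟨_, _, (envAt_eq_some hC).2 (.inl ⟨C₂, C₁, u, rfl, rfl, rfl⟩), rfl, rfl⟩
  · rintro ⟨n, v, h, rfl, rfl⟩
    rcases (envAt_eq_some hC).1 h with ⟨C₂, C₁, u, rfl, rfl, rfl⟩ | ⟨m, w, -, h, -⟩
    · exact ⟨_, .mk C₂ C₁ u⟩
    · cases h

theorem shallowAt_mul_iff {σ : ℕ → Option Term} {C : Ctx} {t r : Term} :
    ShallowAt σ .m C t r ↔ C.Shallow ∧
      ∃ a u b, mulRoot a u = some b ∧ t = C.plug (.app a u) ∧ r = C.plug b := by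
  constructor
  · generalize hk : Kind.m = k
    intro h
    induction h with
    | var => cases hk
    | mul h => exact ⟨trivial, _, _, _, h, rfl, rfl⟩
    | lam _ ih | appL _ ih | appR _ ih | es _ ih =>
      obtain ⟨hC, a, u, b, h, rfl, rfl⟩ := ih hk
      exact ⟨hC, a, u, b, h, rfl, rfl⟩
  · rintro ⟨hC, a, u, b, h, rfl, rfl⟩
    induction C generalizing σ with
    | hole => exact .mul h
    | lam C ih => exact .lam (ih hC)
    | appL C t ih => exact .appL (ih hC)
    | appR t C ih => exact .appR (ih hC)
    | esL C t ih => exact .es (ih hC)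
    | esR => cases hC

theorem shallowAt_exp_iff {σ : ℕ → Option Term} {C : Ctx} {t r : Term} :
    ShallowAt σ .e C t r ↔ C.Shallow ∧
      ∃ n v, envAt σ C n = some v ∧ t = C.plug (.var n) ∧ r = C.plug v := by
  constructor
  · generalize hk : Kind.e = k
    intro h
    induction h with
    | mul => cases hk
    | var h => exact ⟨trivial, _, _, h, rfl, rfl⟩
    | lam _ ih | appL _ ih | appR _ ih | es _ ih =>
      obtain ⟨hC, n, v, h, rfl, rfl⟩ := ih hk
      exact ⟨hC, n, v, h, rfl, rfl⟩
  · rintro ⟨hC, n, v, h, rfl, rfl⟩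
    induction C generalizing σ with
    | hole => exact .var h
    | lam C ih => exact .lam (ih hC h)
    | appL C t ih => exact .appL (ih hC h)
    | appR t C ih => exact .appR (ih hC h)
    | esL C t ih => exact .es (ih hC h)
    | esR => cases hC

theorem shallowAt_iff {k : Kind} {C : Ctx} {t r : Term} :
    ShallowAt (fun _ => none) k C t r ↔ C.Shallow ∧ RedAt k C t r := by
  cases k with
  | m => rw [shallowAt_mul_iff, RedAt, mulAt_iff]
  | e =>
    rw [shallowAt_exp_iff, RedAt]
    exact and_congr_right fun hC => (exists_expAt_iff hC).symm

theorem isShallowRedex_iff {C : Ctx} {t : Term} :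
    IsShallowRedex C t ↔ ∃ k r, ShallowAt (fun _ => none) k C t r := by
  simp only [shallowAt_iff, IsShallowRedex]
  tauto

theorem loAt_iff {k : Kind} {C : Ctx} {t r : Term} :
    LOAt (fun _ => none) k C t r ↔ IsLORedex C t ∧ RedAt k C t r := by
  constructor
  · intro h
    have h' := shallowAt_iff.1 h.shallowAt
    refine ⟨⟨⟨h'.1, k, r, h'.2⟩, fun C' hC' hne => ?_⟩, h'.2⟩
    obtain ⟨k', r', hC'⟩ := isShallowRedex_iff.1 hC'
    exact h.lo hC' hne
  · rintro ⟨⟨hs, hmin⟩, hr⟩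
    have hs' := shallowAt_iff.2 ⟨hs.1, hr⟩
    obtain ⟨⟨k', r'⟩, hp⟩ := Option.ne_none_iff_exists'.1 hs'.loStep_ne_none
    obtain ⟨C', hC'⟩ := exists_loAt hp
    -- The redex found by `loStep` precedes every other one, and so does the given one; by asymmetry
    -- they coincide.
    have heq : C' = C := by
      by_contra hne
      exact (hmin C' (isShallowRedex_iff.2 ⟨_, _, hC'.shallowAt⟩) hne).asymm
        (hC'.lo hs' (Ne.symm hne))
    subst heq
    obtain ⟨rfl, rfl⟩ := hs'.unique hC'.shallowAt
    exact hC'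

theorem loStep_iff {k : Kind} {t r : Term} :
    LOStep k t r ↔ loStep (fun _ => none) t = some (k, r) := by
  constructor
  · rintro ⟨C, h⟩
    exact (loAt_iff.2 h).loStep
  · intro h
    obtain ⟨C, h⟩ := exists_loAt h
    exact ⟨C, loAt_iff.1 h⟩

theorem LOStep.bisim {k : Kind} {t u w : Term} (h : StructEq t u) (hs : LOStep k u w) :
    ∃ r, LOStep k t r ∧ StructEq r w := by
  rw [loStep_iff] at hs
  have := h.loStep fun _ => none
  rw [hs] at this
  generalize hp : StrongMAM.loStep (fun _ => none) t = p at this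
  cases this with
  | @some a _ h => exact ⟨a.2, loStep_iff.2 (hp.trans (congrArg some (Prod.ext h.1 rfl))), h.2⟩

theorem LOStep.deterministic {k k' : Kind} {t t' t'' : Term} (h : LOStep k t t')
    (h' : LOStep k' t t'') : k = k' ∧ t' = t'' := by
  rw [loStep_iff] at h h'
  simpa [h] using h'

/-! ## Codes and their terms -/

/-- The free variables of a term. -/
def Term.fvSet : Term → Set ℕ
  | var n => {n}
  | lam t => {n | n + 1 ∈ t.fvSet}
  | app t u => t.fvSet ∪ u.fvSet
  | es t u => {n | n + 1 ∈ t.fvSet} ∪ u.fvSet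

namespace Code

theorem toTerm_rename {t : Code} {Γ Γ' : List Name} {f : ℕ → ℕ}
    (h : ∀ x ∈ t.fv, index Γ' x = f (index Γ x)) : t.toTerm Γ' = (t.toTerm Γ).rename f := by
  induction t generalizing Γ Γ' f with
  | var x => simpa [toTerm, Term.rename, fv] using h
  | lam x t ih =>
    simp only [toTerm, Term.rename, Term.lam.injEq]
    apply ih
    intro y hy
    by_cases hyx : y = x
    · simp [index, hyx, upRen]
    · simp [index, hyx, upRen, h y (by simp [fv, hyx, hy])]
  | app t u iht ihu =>
    simp only [fv, Finset.mem_union] at h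
    simp only [toTerm, Term.rename, Term.app.injEq]
    exact ⟨iht fun x hx => h x (.inl hx), ihu fun x hx => h x (.inr hx)⟩

theorem toTerm_cons {t : Code} {x : Name} (Γ : List Name) (h : x ∉ t.fv) :
    t.toTerm (x :: Γ) = (t.toTerm Γ).shift 1 := by
  refine toTerm_rename fun y hy => ?_
  have : y ≠ x := fun e => h (e ▸ hy)
  simp [index, this]

/-- α-equivalence is defined in the empty scope, and `index Γ` is itself the renaming that leads
from the empty scope to `Γ`. -/
theorem AlphaEq.toTerm_eq {t u : Code} (h : t.AlphaEq u) (Γ : List Name) :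
    t.toTerm Γ = u.toTerm Γ := by
  rw [toTerm_rename (Γ := []) (f := index Γ) fun _ _ => rfl, h,
    ← toTerm_rename (Γ := []) (f := index Γ) fun _ _ => rfl]

theorem mem_fvSet_toTerm {t : Code} {Γ : List Name} {n : ℕ} :
    n ∈ (t.toTerm Γ).fvSet ↔ ∃ x ∈ t.fv, index Γ x = n := by
  induction t generalizing Γ n with
  | var x => simp [toTerm, Term.fvSet, fv, eq_comm]
  | lam x t ih =>
    simp only [toTerm, Term.fvSet, Set.mem_ofPred_eq, ih, fv, Finset.mem_erase]
    refine exists_congr fun y => ?_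
    by_cases hyx : y = x <;> simp [index, hyx]
  | app t u iht ihu =>
    simp only [toTerm, Term.fvSet, Set.mem_union, iht, ihu, fv, Finset.mem_union]
    constructor
    · rintro (⟨x, h, h'⟩ | ⟨x, h, h'⟩)
      exacts [⟨x, .inl h, h'⟩, ⟨x, .inr h, h'⟩]
    · rintro ⟨x, h | h, h'⟩
      exacts [.inl ⟨x, h, h'⟩, .inr ⟨x, h, h'⟩]

theorem AlphaEq.fv_eq {t u : Code} (h : t.AlphaEq u) : t.fv = u.fv := by
  ext x
  have ht := mem_fvSet_toTerm (t := t) (Γ := []) (n := x)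
  have hu := mem_fvSet_toTerm (t := u) (Γ := []) (n := x)
  rw [h] at ht
  simpa [index] using ht.symm.trans hu

/-- Abstractions. -/
def IsLam : Code → Prop
  | lam _ _ => True
  | _ => False

/-- β-normal codes. -/
def Normal : Code → Prop
  | var _ => True
  | lam _ t => t.Normal
  | app t u => ¬ t.IsLam ∧ t.Normal ∧ u.Normal

theorem mulRoot_toTerm {t : Code} (h : ¬ t.IsLam) (Γ : List Name) (u : Term) :
    mulRoot (t.toTerm Γ) u = none := by
  cases t with
  | lam => exact absurd trivial h
  | var | app => rfl

theorem Normal.loStep_toTerm {t : Code} (ht : t.Normal) {Γ : List Name} {σ : ℕ → Option Term}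
    (h : ∀ x ∈ t.fv, σ (index Γ x) = none) : loStep σ (t.toTerm Γ) = none := by
  induction t generalizing Γ σ with
  | var x => simp [toTerm, loStep, h x (by simp [fv])]
  | lam x t ih =>
    simp only [toTerm, loStep, inCtx, Option.map_eq_none_iff]
    refine ih ht fun y hy => ?_
    by_cases hyx : y = x
    · simp [index, hyx, upEnv]
    · simp [index, hyx, upEnv, h y (by simp [fv, hyx, hy])]
  | app t u iht ihu =>
    simp only [fv, Finset.mem_union] at h
    simp [toTerm, loStep, mulRoot_toTerm ht.1, iht ht.2.1 fun x hx => h x (.inl hx),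
      ihu ht.2.2 fun x hx => h x (.inr hx), inCtx]

/-- Binders are named by increasing numbers. `N` exceeds all names in scope and is the first
available one; `M` is the next one available afterwards and is passed from the left to the right
part of an application, which keeps their binders disjoint. -/
theorem exists_toTerm_eq {t : Term} (ht : t.Pure) {Γ : List Name} (hcl : t.ClosedAt Γ.length)
    (hΓ : Γ.Nodup) {N : ℕ} (hN : ∀ x ∈ Γ, x < N) :
    ∃ c : Code, c.toTerm Γ = t ∧ (∀ x ∈ c.fv, x ∈ Γ) ∧ c.binders.Nodup ∧
      (∀ x ∈ c.binders, N ≤ x) ∧ ∃ M, N ≤ M ∧ ∀ x ∈ c.binders, x < M := by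
  induction t generalizing Γ N with
  | var n =>
    have hindex : ∀ {Γ : List Name} (hΓ : Γ.Nodup) {n : ℕ} (h : n < Γ.length),
        index Γ Γ[n] = n := by
      intro Γ hΓ n h
      induction Γ generalizing n with
      | nil => simp at h
      | cons x Γ ih =>
        rw [List.nodup_cons] at hΓ
        cases n with
        | zero => simp [index]
        | succ n =>
          have hn : n < Γ.length := by simpa using h
          have : Γ[n] ≠ x := fun e => hΓ.1 (e ▸ List.getElem_mem hn)
          simp [index, this, ih hΓ.2 hn]
    refine ⟨.var (Γ[n]'hcl), ?_, ?_, ?_, ?_, N, le_rfl, ?_⟩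
    · simp [toTerm, hindex hΓ hcl]
    · simp only [fv, Finset.mem_singleton, forall_eq]
      exact List.getElem_mem _
    all_goals simp [binders]
  | lam t ih =>
    obtain ⟨c, hc, hfv, hnd, hlb, M, hM, hub⟩ := ih ht (Γ := N :: Γ) (N := N + 1)
      hcl (List.nodup_cons.2 ⟨fun h => lt_irrefl _ (hN _ h), hΓ⟩)
      (by
        simp only [List.mem_cons, forall_eq_or_imp]
        exact ⟨N.lt_succ_self, fun x hx => (hN x hx).trans N.lt_succ_self⟩)
    refine ⟨.lam N c, by simp [toTerm, hc], ?_, ?_, ?_, M, by omega, ?_⟩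
    · intro x hx
      simp only [fv, Finset.mem_erase] at hx
      simpa [hx.1] using hfv x hx.2
    · exact List.nodup_cons.2 ⟨fun h => absurd (hlb _ h) (by omega), hnd⟩
    · simp only [binders, List.mem_cons, forall_eq_or_imp, le_refl, true_and]
      exact fun x hx => (Nat.le_succ N).trans (hlb x hx)
    · simp only [binders, List.mem_cons, forall_eq_or_imp]
      exact ⟨hM, hub⟩
  | app t u iht ihu =>
    obtain ⟨c, hc, hfv, hnd, hlb, M, hM, hub⟩ := iht ht.1 hcl.1 hΓ hN
    obtain ⟨d, hd, hfv', hnd', hlb', M', hM', hub'⟩ := ihu ht.2 hcl.2 hΓ (N := M)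
      fun x hx => (hN x hx).trans_le hM
    refine ⟨.app c d, by simp [toTerm, hc, hd], ?_, ?_, ?_, M', hM.trans hM', ?_⟩
    · simp only [fv, Finset.mem_union]
      exact fun x hx => hx.elim (hfv x) (hfv' x)
    · exact hnd.append hnd' fun x hx hx' => absurd (hub x hx) (hlb' x hx').not_gt
    · simp only [binders, List.mem_append]
      exact fun x hx => hx.elim (hlb x) fun h => hM.trans (hlb' x h)
    · simp only [binders, List.mem_append]
      exact fun x hx => hx.elim (fun h => (hub x h).trans_le hM') (hub' x)
  | es => cases ht

end Code

/-! ## The invariants of the machine -/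

/-- The names bound by an environment without closed scopes, innermost first. -/
def envScope : Env → List Name
  | [] => []
  | .sub x _ :: L => x :: envScope L
  | .opening x :: L => x :: envScope L
  | .closing _ :: L => envScope L

/-- The terms that an environment without closed scopes substitutes for the variables. -/
def envAssign : Env → ℕ → Option Term
  | [] => fun _ => none
  | .sub _ u :: L => upEnv (some (u.toTerm (envScope L))) (envAssign L)
  | .opening _ :: L => upEnv none (envAssign L)
  | .closing _ :: L => envAssign L

/-- The binders of the codes of a stack. -/
def stackBinders (π : Stack) : List Name := π.flatMap Code.binders

/-- The binders of the codes of a frame that are still to be evaluated. -/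
def frameBinders : Frame → List Name
  | [] => []
  | .pair _ π :: F => stackBinders π ++ frameBinders F
  | .abs _ :: F => frameBinders F

/-- The invariant on a frame and an environment without closed scopes, decomposed as in the
decoding. -/
inductive FrameInv : Frame → Env → Prop
  | nil : FrameInv [] []
  | pair {u π F L} : u.Normal → ¬ u.IsLam → (∀ x ∈ u.fv, lookupLive L x = .opened) →
      (∀ t ∈ π, ∀ x ∈ t.fv, x ∈ envScope L) → FrameInv F L → FrameInv (.pair u π :: F) L
  | sub {F x u L} : TrunkFrame F → (∀ y ∈ u.fv, y ∈ envScope L) → FrameInv F L →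
      FrameInv F (.sub x u :: L)
  | abs {x F L} : FrameInv F L → FrameInv (.abs x :: F) (.opening x :: L)

theorem lookupLive_ne_undefined {L : Env} {x : Name} (h : x ∈ envScope L) :
    lookupLive L x ≠ .undefined := by
  induction L with
  | nil => simp [envScope] at h
  | cons e L ih =>
    cases e with
    | closing y => exact ih h
    | sub y | opening y =>
      by_cases hxy : x = y
      · simp [lookupLive, hxy]
      · simpa [lookupLive, hxy] using ih (by simpa [envScope, hxy] using h)

theorem lookupLive_opened {L : Env} {x : Name} (h : lookupLive L x = .opened) :
    x ∈ envScope L ∧ envAssign L (index (envScope L) x) = none := by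
  induction L with
  | nil => simp [lookupLive] at h
  | cons e L ih =>
    cases e with
    | closing y => exact ih h
    | sub y =>
      by_cases hxy : x = y
      · simp [lookupLive, hxy] at h
      · simpa [envScope, envAssign, index, hxy, upEnv] using ih (by simpa [lookupLive, hxy] using h)
    | opening y =>
      by_cases hxy : x = y
      · simp [envScope, envAssign, index, hxy, upEnv]
      · simpa [envScope, envAssign, index, hxy, upEnv] using ih (by simpa [lookupLive, hxy] using h)

/-- Crossing an entry shifts the assigned term, and this agrees with decoding `t` in the larger
scope because the names in scope are distinct: the newer name is not free in `t`, so nothing is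
captured. -/
theorem FrameInv.lookupLive_code {F : Frame} {L : Env} (hF : FrameInv F L)
    (hL : (envScope L).Nodup) {x : Name} {t : Code} (h : lookupLive L x = .code t) :
    (∀ y ∈ t.fv, y ∈ envScope L) ∧
      envAssign L (index (envScope L) x) = some (t.toTerm (envScope L)) := by
  induction hF with
  | nil => simp [lookupLive] at h
  | pair _ _ _ _ _ ih => exact ih hL h
  | @sub F y u L _ hu _ ih =>
    rw [envScope, List.nodup_cons] at hL
    by_cases hxy : x = y
    · obtain rfl : u = t := by simpa [lookupLive, hxy] using h
      refine ⟨fun z hz => List.mem_cons_of_mem _ (hu z hz), ?_⟩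
      simp [envScope, envAssign, index, hxy, upEnv,
        Code.toTerm_cons _ fun hy => hL.1 (hu y hy)]
    · obtain ⟨h1, h2⟩ := ih hL.2 (by simpa [lookupLive, hxy] using h)
      refine ⟨fun z hz => List.mem_cons_of_mem _ (h1 z hz), ?_⟩
      simp [envScope, envAssign, index, hxy, upEnv, h2,
        Code.toTerm_cons _ fun hy => hL.1 (h1 y hy)]
  | @abs y F L _ ih =>
    rw [envScope, List.nodup_cons] at hL
    by_cases hxy : x = y
    · simp [lookupLive, hxy] at h
    · obtain ⟨h1, h2⟩ := ih hL.2 (by simpa [lookupLive, hxy] using h)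
      refine ⟨fun z hz => List.mem_cons_of_mem _ (h1 z hz), ?_⟩
      simp [envScope, envAssign, index, hxy, upEnv, h2,
        Code.toTerm_cons _ fun hy => hL.1 (h1 y hy)]

/-- The decoding places a new substitution outside the pairs on top of the frame, so it has to pass
below them. It does not disturb them, as their evaluated codes mention only names already in scope.
-/
theorem FrameInv.add_sub {F : Frame} {L : Env} (hF : FrameInv F L) {x : Name} {u : Code}
    (hx : x ∉ envScope L) (hu : ∀ y ∈ u.fv, y ∈ envScope L) : FrameInv F (.sub x u :: L) := by
  induction hF with
  | nil => exact .sub .nil hu .nil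
  | pair hn hl ho hπ _ ih =>
    refine .pair hn hl (fun y hy => ?_) (fun t ht y hy => List.mem_cons_of_mem _ (hπ t ht y hy))
      (ih hx hu)
    have hyx : y ≠ x := fun e => hx (e ▸ (lookupLive_opened (ho y hy)).1)
    simpa [lookupLive, hyx] using ho y hy
  | sub hF hu' h _ => exact .sub hF hu (.sub hF hu' h)
  | abs h _ => exact .sub (.abs _ _) hu (.abs h)

/-- Only substitutions can lie above the marker of `x`; dropping them affects no variable whose look
up is an open scope. -/
theorem FrameInv.closeScope {x : Name} {F : Frame} {L : Env} (h : FrameInv (.abs x :: F) L) :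
    FrameInv F (closeScope L) ∧ (x :: envScope (closeScope L)) <:+ envScope L ∧
      ∀ y, y ≠ x → lookupLive L y = .opened → lookupLive (StrongMAM.closeScope L) y = .opened := by
  generalize hF : FrameEntry.abs x :: F = F' at h
  induction h with
  | nil | pair => cases hF
  | @sub _ z _ _ _ _ _ ih =>
    obtain ⟨h1, h2, h3⟩ := ih hF
    refine ⟨h1, h2.trans (List.suffix_cons _ _), fun y hy h => h3 y hy ?_⟩
    by_cases hyz : y = z
    · simp [lookupLive, hyz] at h
    · simpa [lookupLive, hyz] using h
  | abs h _ =>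
    cases hF
    refine ⟨h, List.suffix_rfl, fun y hy h => ?_⟩
    simpa [lookupLive, hy, StrongMAM.closeScope] using h

/-- The binders of the codes of a state that are still to be evaluated. -/
def State.activeBinders : State → List Name
  | ⟨.eval, F, t, π, _⟩ => t.binders ++ (stackBinders π ++ frameBinders F)
  | ⟨.back, F, _, π, _⟩ => stackBinders π ++ frameBinders F

/-- The invariant of the reachable states. -/
structure State.Inv (s : State) : Prop where
  compatible : Compatible s.frame s.env
  frame : FrameInv s.frame (live s.env)
  nodup : (envScope (live s.env) ++ s.activeBinders).Nodup
  stack : ∀ t ∈ s.stack, ∀ x ∈ t.fv, x ∈ envScope (live s.env)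
  code : ∀ x ∈ s.code.fv, x ∈ envScope (live s.env)
  back : s.phase = .back → s.code.Normal ∧ (s.stack ≠ [] → ¬ s.code.IsLam) ∧
    ∀ x ∈ s.code.fv, lookupLive (live s.env) x = .opened

theorem State.Inv.nodup_envScope {s : State} (h : s.Inv) : (envScope (live s.env)).Nodup :=
  (List.nodup_append.1 h.nodup).1

/-! ### Compatibility -/

theorem WeakEnv.append {E E' : Env} (h : WeakEnv E) (h' : WeakEnv E') : WeakEnv (E ++ E') := by
  induction h with
  | nil => exact h'
  | sub x t _ ih => exact .sub x t ih
  | scope x h _ _ ih =>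
    rw [List.cons_append, List.append_assoc, List.cons_append]
    exact .scope x h ih

theorem Compatible.wellFormedEnv {F : Frame} {E : Env} (h : Compatible F E) :
    WellFormedEnv E := by
  induction h with
  | nil => exact .weak .nil
  | @weak _ _ Ew _ _ _ hE hE' _ _ =>
    cases hE' with
    | nil => simpa using WellFormedEnv.weak hE
    | scope x h => exact .scope x hE h
  | abs x _ ih => exact .scope x .nil ih

theorem Compatible.append_weakEnv {F : Frame} {E Ew : Env} (h : Compatible F E)
    (hw : WeakEnv Ew) : Compatible F (Ew ++ E) := by
  cases h with
  | nil => exact .weak (Fw := []) .nil .nil hw .nil .nil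
  | weak h1 h2 h3 h4 h5 =>
    rw [← List.append_assoc]
    exact .weak h1 h2 (hw.append h3) h4 h5
  | abs x h =>
    exact .weak (Fw := []) .nil (.abs _ _) hw (.scope x h.wellFormedEnv) (.abs x h)

theorem Compatible.pair {F : Frame} {E : Env} (h : Compatible F E) (t : Code) (π : Stack) :
    Compatible (.pair t π :: F) E := by
  cases h with
  | nil => exact .weak (Ew := []) (.pair t π .nil) .nil .nil .nil .nil
  | weak h1 h2 h3 h4 h5 => exact .weak (Fw := .pair t π :: _) (.pair t π h1) h2 h3 h4 h5
  | abs x h =>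
    exact .weak (Fw := [_]) (Ew := []) (.pair t π .nil) (.abs _ _) .nil
      (.scope x h.wellFormedEnv) (.abs x h)

theorem Compatible.of_pair {F : Frame} {E : Env} {t : Code} {π : Stack}
    (h : Compatible (.pair t π :: F) E) : Compatible F E := by
  generalize hF' : FrameEntry.pair t π :: F = F' at h
  cases h with
  | nil | abs => cases hF'
  | weak h1 h2 h3 h4 h5 =>
    cases h1 with
    | nil => cases h2 <;> cases hF'
    | pair _ _ h1 =>
      cases hF'
      exact .weak h1 h2 h3 h4 h5

theorem Compatible.of_abs {F : Frame} {E : Env} {x : Name} (h : Compatible (.abs x :: F) E) :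
    ∃ Ew E', E = Ew ++ .opening x :: E' ∧ WeakEnv Ew ∧ Compatible F E' := by
  generalize hF' : FrameEntry.abs x :: F = F' at h
  induction h with
  | nil => cases hF'
  | abs y h _ =>
    cases hF'
    exact ⟨[], _, rfl, .nil, h⟩
  | weak h1 h2 h3 h4 h5 ih =>
    cases h1 with
    | pair => cases hF'
    | nil =>
      -- The rule `weak` can be iterated with empty weak frames; the weak environments met on the
      -- way are concatenated.
      obtain ⟨Ew, E', rfl, hw, h⟩ := ih hF'
      exact ⟨_, E', (List.append_assoc ..).symm, h3.append hw, h⟩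

/-! ### Names -/

theorem envScope_closeScope_subset (L : Env) : ∀ x ∈ envScope (closeScope L), x ∈ envScope L := by
  induction L with
  | nil => simp [closeScope]
  | cons e L ih =>
    cases e with
    | sub y t => exact fun x hx => List.mem_cons_of_mem _ (ih x hx)
    | opening y => exact fun x hx => List.mem_cons_of_mem _ hx
    | closing y => exact ih

theorem mem_envNames {E : Env} {x : Name} (h : x ∈ envScope (live E)) : x ∈ envNames E := by
  induction E with
  | nil => simp [live, envScope] at h
  | cons e E ih =>
    cases e with
    | sub y t | opening y =>
      simp only [live, envScope, List.mem_cons] at h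
      simp only [envNames, Finset.mem_union, Finset.mem_singleton]
      tauto
    | closing y =>
      simp only [envNames, Finset.mem_union]
      exact .inr (ih (envScope_closeScope_subset _ x h))

theorem mem_stackNames {π : Stack} {x : Name} (h : x ∈ stackBinders π) : x ∈ stackNames π := by
  induction π with
  | nil => simp [stackBinders] at h
  | cons t π ih =>
    simp only [stackBinders, List.flatMap_cons, List.mem_append] at h
    simp only [stackNames, Code.names, Finset.mem_union, List.mem_toFinset]
    exact h.imp .inr ih

theorem mem_frameNames {F : Frame} {x : Name} (h : x ∈ frameBinders F) : x ∈ frameNames F := by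
  induction F with
  | nil => simp [frameBinders] at h
  | cons e F ih =>
    cases e with
    | pair t π =>
      simp only [frameBinders, List.mem_append] at h
      simp only [frameNames, Finset.mem_union]
      exact h.imp (fun h => .inr (mem_stackNames h)) ih
    | abs y =>
      simp only [frameNames, Finset.mem_union]
      exact .inr (ih h)

/-! ### Preservation of the invariant -/

/-- Transitions move or discard names between the scope and the active binders; comparing
multiplicities spares explicit permutations. -/
theorem nodup_of_count_le {l l' : List Name} (h : l.Nodup) (h' : ∀ x, l'.count x ≤ l.count x) :
    l'.Nodup :=
  List.nodup_iff_count_le_one.2 fun x => (h' x).trans (List.nodup_iff_count_le_one.1 h x)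

theorem State.inv_initial {t : Code} (h : t.IsInitial) : State.Inv ⟨.eval, [], t, [], []⟩ where
  compatible := .nil
  frame := .nil
  nodup := by simpa [live, envScope, activeBinders, stackBinders, frameBinders] using h.2.1
  stack := by simp
  code := by simp [h.1]
  back := by simp

theorem State.Inv.step {ρ : State → Code → Code} (hρ : IsFreshRenaming ρ) {τ : Trans}
    {s s' : State} (h : s.Inv) (hs : Step ρ τ s s') : s'.Inv := by
  obtain ⟨hc, hF, hn, hπ, ht, hb⟩ := h
  cases hs with
  | c1 F t u π E =>
    simp only [Code.fv, Finset.mem_union] at ht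
    refine ⟨hc, hF, ?_, ?_, fun x hx => ht x (.inl hx), by simp⟩
    · simpa [activeBinders, Code.binders, stackBinders] using hn
    · simp only [List.mem_cons, forall_eq_or_imp]
      exact ⟨fun x hx => ht x (.inr hx), hπ⟩
  | m F x t u π E =>
    simp only [List.mem_cons, forall_eq_or_imp] at hπ
    have hx : x ∉ envScope (live E) := by
      intro hx
      exact (List.nodup_append.1 hn).2.2 x hx x (by simp [activeBinders, Code.binders]) rfl
    refine ⟨hc.append_weakEnv (.sub x u .nil), hF.add_sub hx hπ.1, ?_, ?_, ?_, by simp⟩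
    · refine nodup_of_count_le hn fun y => ?_
      simp only [live, envScope, activeBinders, Code.binders, stackBinders, List.flatMap_cons,
        List.count_append, List.count_cons]
      omega
    · exact fun w hw y hy => List.mem_cons_of_mem _ (hπ.2 w hw y hy)
    · intro y hy
      by_cases hyx : y = x
      · simp [live, envScope, hyx]
      · exact List.mem_cons_of_mem _ (ht y (by simp [Code.fv, hyx, hy]))
  | c2 F x t E =>
    refine ⟨.abs x hc, .abs hF, ?_, by simp, ?_, by simp⟩
    · refine nodup_of_count_le hn fun y => ?_
      simp only [live, envScope, activeBinders, Code.binders, frameBinders,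
        List.count_append, List.count_cons]
      omega
    · intro y hy
      by_cases hyx : y = x
      · simp [live, envScope, hyx]
      · exact List.mem_cons_of_mem _ (ht y (by simp [Code.fv, hyx, hy]))
  | e F x t π E hx =>
    obtain ⟨hα, hwn, hfresh⟩ := hρ ⟨.eval, F, .var x, π, E⟩ t
    refine ⟨hc, hF, ?_, hπ, ?_, by simp⟩
    · rw [List.nodup_iff_count_le_one] at hn ⊢
      intro y
      have h1 := hn y
      have h2 := List.nodup_iff_count_le_one.1 hwn.1 y
      simp only [activeBinders, Code.binders, List.count_append, List.count_nil] at h1 h2 ⊢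
      -- A binder of the copy occurs once in it and, by freshness, nowhere else in the state; any
      -- other name keeps its multiplicity.
      by_cases hy : y ∈ (ρ ⟨.eval, F, .var x, π, E⟩ t).binders
      · have h3 := hfresh y hy
        simp only [names, Finset.mem_union, not_or] at h3
        rw [List.count_eq_zero.2 fun h => h3.2 (mem_envNames h),
          List.count_eq_zero.2 fun h => h3.1.2 (mem_stackNames h),
          List.count_eq_zero.2 fun h => h3.1.1.1 (mem_frameNames h)]
        omega
      · rw [List.count_eq_zero.2 hy]
        omega
    · intro y hy
      rw [hα.fv_eq] at hy
      exact (hF.lookupLive_code (List.nodup_append.1 hn).1 hx).1 y hy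
  | c3 F x π E hx =>
    refine ⟨hc, hF, hn, hπ, ht, fun _ => ⟨trivial, fun _ h => h, ?_⟩⟩
    simpa [Code.fv, lookup] using hx
  | c4 F x t E =>
    obtain ⟨hn', -, ho⟩ := hb rfl
    obtain ⟨Ew, E', hE, hw, hc'⟩ := hc.of_abs
    obtain ⟨h1, h2, h3⟩ := hF.closeScope
    have ho' : ∀ y ∈ (Code.lam x t).fv, lookupLive (closeScope (live E)) y = .opened := by
      simp only [Code.fv, Finset.mem_erase]
      exact fun y hy => h3 y hy.1 (ho y hy.2)
    refine ⟨?_, h1, ?_, by simp, fun y hy => (lookupLive_opened (ho' y hy)).1,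
      fun _ => ⟨hn', by simp, ho'⟩⟩
    · have := hc'.append_weakEnv (.scope x hw .nil)
      change E = _ at hE
      simpa [hE] using this
    · refine nodup_of_count_le hn fun y => ?_
      -- Closing the scope only removes names, namely `x` and those of the substitutions above its
      -- marker.
      have := ((List.suffix_cons _ _).trans h2).sublist.count_le y
      simp only [live, activeBinders, frameBinders, List.count_append] at this ⊢
      omega
  | c5 F t u π E =>
    obtain ⟨hn', -, ho⟩ := hb rfl
    simp only at hF
    generalize hL : live E = L at hF
    cases hF with
    | pair h1 h2 h3 h4 h5 =>
      subst hL
      have ho' : ∀ y ∈ (Code.app t u).fv, lookupLive (live E) y = .opened := by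
        simp only [Code.fv, Finset.mem_union]
        exact fun y hy => hy.elim (h3 y) (ho y)
      refine ⟨hc.of_pair, h5, ?_, h4, fun y hy => (lookupLive_opened (ho' y hy)).1,
        fun _ => ⟨⟨h2, h1, hn'⟩, fun _ h => h, ho'⟩⟩
      simpa [activeBinders, stackBinders, frameBinders] using hn
    | sub h => cases h
  | c6 F t u π E =>
    obtain ⟨hn', hl, ho⟩ := hb rfl
    simp only [List.mem_cons, forall_eq_or_imp] at hπ
    refine ⟨hc.pair t π, .pair hn' (hl (by simp)) ho hπ.2 hF, ?_, by simp, hπ.1, by simp⟩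
    simpa [activeBinders, stackBinders, frameBinders] using hn

/-! ## Decoding of states satisfying the invariant -/

theorem NCtx.toCtx_comp (A B : NCtx) (Γ : List Name) :
    (A.comp B).toCtx Γ = (A.toCtx Γ).comp (B.toCtx (A.scope Γ)) := by
  induction A generalizing Γ <;> simp_all [comp, toCtx, scope, Ctx.comp]

theorem NCtx.scope_comp (A B : NCtx) (Γ : List Name) :
    (A.comp B).scope Γ = B.scope (A.scope Γ) := by
  induction A generalizing Γ <;> simp_all [comp, scope]

theorem Ctx.comp_assoc (A B C : Ctx) : (A.comp B).comp C = A.comp (B.comp C) := by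
  induction A <;> simp_all [comp]

theorem Ctx.comp_hole (A : Ctx) : A.comp .hole = A := by
  induction A <;> simp_all [comp]

theorem Ctx.plug_injective (C : Ctx) {t u : Term} (h : C.plug t = C.plug u) : t = u := by
  induction C <;> simp_all [plug]

theorem scope_decodeStack (π : Stack) (Γ : List Name) : (decodeStack π).scope Γ = Γ := by
  induction π with
  | nil => rfl
  | cons u π ih => simp [decodeStack, NCtx.scope_comp, ih, NCtx.scope]

theorem decodeLive_pair (u : Code) (π : Stack) (F : Frame) (L : Env) :
    decodeLive (.pair u π :: F) L
      = (decodeLive F L).comp ((decodeStack π).comp (.appR u .hole)) := by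
  rw [decodeLive]

theorem decodeLive_sub {F : Frame} (hF : TrunkFrame F) (x : Name) (u : Code) (L : Env) :
    decodeLive F (.sub x u :: L) = (decodeLive F L).comp (.es .hole x u) := by
  cases hF <;> simp [decodeLive]

theorem decodeLive_abs (x y : Name) (F : Frame) (L : Env) :
    decodeLive (.abs x :: F) (.opening y :: L) = (decodeLive F L).comp (.lam x .hole) := by
  simp [decodeLive]

theorem decodeLive_nil : decodeLive [] [] = .hole := by
  simp [decodeLive]

theorem FrameInv.scope {F : Frame} {L : Env} (h : FrameInv F L) :
    (decodeLive F L).scope [] = envScope L := by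
  induction h with
  | nil => simp [decodeLive_nil, NCtx.scope, envScope]
  | pair _ _ _ _ _ ih =>
    simp [decodeLive_pair, NCtx.scope_comp, ih, scope_decodeStack, NCtx.scope]
  | sub hF _ _ ih => simp [decodeLive_sub hF, NCtx.scope_comp, ih, NCtx.scope, envScope]
  | abs _ ih => simp [decodeLive_abs, NCtx.scope_comp, ih, NCtx.scope, envScope]

/-- The context of a frame and an environment without closed scopes, in de Bruijn form. -/
def frameCtx (F : Frame) (L : Env) : Ctx := (decodeLive F L).toCtx []

/-- The context of a stack, in de Bruijn form. -/
def stackCtx (Γ : List Name) (π : Stack) : Ctx := (decodeStack π).toCtx Γ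

theorem stackCtx_cons (Γ : List Name) (u : Code) (π : Stack) :
    stackCtx Γ (u :: π) = (stackCtx Γ π).comp (.appL .hole (u.toTerm Γ)) := by
  simp [stackCtx, decodeStack, NCtx.toCtx_comp, scope_decodeStack, NCtx.toCtx]

theorem stackCtx_cons_plug (Γ : List Name) (u : Code) (π : Stack) (t : Term) :
    (stackCtx Γ (u :: π)).plug t = (stackCtx Γ π).plug (.app t (u.toTerm Γ)) := by
  rw [stackCtx_cons, Ctx.comp_plug]
  rfl

theorem FrameInv.frameCtx_pair {F : Frame} {L : Env} (h : FrameInv F L) (u : Code) (π : Stack) :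
    frameCtx (.pair u π :: F) L = (frameCtx F L).comp
      ((stackCtx (envScope L) π).comp (.appR (u.toTerm (envScope L)) .hole)) := by
  simp [frameCtx, stackCtx, decodeLive_pair, NCtx.toCtx_comp, h.scope, scope_decodeStack,
    NCtx.toCtx]

theorem FrameInv.frameCtx_sub {F : Frame} {L : Env} (h : FrameInv F L) (hF : TrunkFrame F)
    (x : Name) (u : Code) :
    frameCtx F (.sub x u :: L) = (frameCtx F L).comp (.esL .hole (u.toTerm (envScope L))) := by
  simp [frameCtx, decodeLive_sub hF, NCtx.toCtx_comp, h.scope, NCtx.toCtx]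

theorem frameCtx_abs (x y : Name) (F : Frame) (L : Env) :
    frameCtx (.abs x :: F) (.opening y :: L) = (frameCtx F L).comp (.lam .hole) := by
  simp [frameCtx, decodeLive_abs, NCtx.toCtx_comp, NCtx.toCtx]

theorem State.Inv.scope_stateCtx {s : State} (h : s.Inv) :
    (stateCtx s).scope [] = envScope (live s.env) := by
  simp [stateCtx, decodePair, NCtx.scope_comp, h.frame.scope, scope_decodeStack]

theorem State.Inv.toCtx_stateCtx {s : State} (h : s.Inv) :
    (stateCtx s).toCtx [] = (frameCtx s.frame (live s.env)).comp
      (stackCtx (envScope (live s.env)) s.stack) := by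
  simp [stateCtx, decodePair, NCtx.toCtx_comp, h.frame.scope, frameCtx, stackCtx]

theorem State.Inv.decode_eq {s : State} (h : s.Inv) :
    decode s = (frameCtx s.frame (live s.env)).plug
      ((stackCtx (envScope (live s.env)) s.stack).plug (s.code.toTerm (envScope (live s.env)))) := by
  rw [decode, NCtx.plugCode, h.toCtx_stateCtx, h.scope_stateCtx, Ctx.comp_plug]

/-! ### Evaluation contexts of the machine -/

/-- Only the innermost application could become a multiplicative redex, which `ht` excludes; from
then on the left part is itself an application. -/
theorem LOAt.stackCtx {σ : ℕ → Option Term} {k : Kind} {D : Ctx} {t r : Term}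
    (h : LOAt σ k D t r) (ht : ∀ u, mulRoot t u = none) (Γ : List Name) (π : Stack) :
    LOAt σ k ((stackCtx Γ π).comp D) ((stackCtx Γ π).plug t) ((stackCtx Γ π).plug r) := by
  induction π generalizing D t r with
  | nil => exact h
  | cons u π ih =>
    simp only [stackCtx_cons, Ctx.comp_assoc, Ctx.comp_plug]
    exact ih (.appL (ht _) h) fun _ => rfl

/-- At a pair, the code on the left is normal, is not an abstraction and has only unassigned
variables, so neither it nor the application reduces. Abstractions and substitutions on the path
contain no competing redex. -/
theorem LOAt.frameCtx {F : Frame} {L : Env} (hF : FrameInv F L) {k : Kind} {D : Ctx}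
    {t r : Term} (h : LOAt (envAssign L) k D t r) :
    LOAt (fun _ => none) k ((frameCtx F L).comp D) ((frameCtx F L).plug t)
      ((frameCtx F L).plug r) := by
  induction hF generalizing D t r with
  | nil => simpa [StrongMAM.frameCtx, decodeLive_nil, NCtx.toCtx, Ctx.comp, Ctx.plug, envAssign] using h
  | @pair u π F L hn hl ho _ hF ih =>
    simp only [hF.frameCtx_pair, Ctx.comp_assoc, Ctx.comp_plug]
    refine ih (LOAt.stackCtx (.appR ?_ ?_ h) (fun _ => rfl) _ _)
    · exact Code.mulRoot_toTerm hl _ _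
    · exact hn.loStep_toTerm fun x hx => (lookupLive_opened (ho x hx)).2
  | sub hF _ h' ih =>
    simp only [h'.frameCtx_sub hF, Ctx.comp_assoc, Ctx.comp_plug]
    exact ih (.es h)
  | abs _ ih =>
    simp only [frameCtx_abs, Ctx.comp_assoc, Ctx.comp_plug]
    exact ih (.lam h)

/-- With an empty frame the context consists of explicit substitutions, whose arguments are never
searched. -/
theorem FrameInv.loStep_eq_none {L : Env} (hF : FrameInv [] L) {t : Term}
    (h : loStep (envAssign L) t = none) :
    loStep (fun _ => none) ((frameCtx [] L).plug t) = none := by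
  generalize hF' : ([] : Frame) = F at hF
  induction hF generalizing t with
  | nil => simpa [frameCtx, decodeLive_nil, NCtx.toCtx, Ctx.plug, envAssign] using h
  | pair | abs => cases hF'
  | sub hF _ h' ih =>
    simp only [h'.frameCtx_sub hF, Ctx.comp_plug]
    exact ih (by simp only [Ctx.plug, loStep]; rw [envAssign] at h; rw [h]; rfl) hF'

/-! ### Moving substitutions -/

theorem stackCtx_es {π : Stack} {x : Name} (hx : ∀ u ∈ π, x ∉ u.fv) (Γ : List Name)
    (t w : Term) :
    StructEq ((stackCtx Γ π).plug (.es t w)) (.es ((stackCtx (x :: Γ) π).plug t) w) := by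
  induction π generalizing t with
  | nil => exact .refl _
  | cons u π ih =>
    simp only [List.mem_cons, forall_eq_or_imp] at hx
    simp only [stackCtx_cons_plug, Code.toTerm_cons Γ hx.1]
    exact ((StructEq.root (.appL _ _ _)).symm.plug _).trans (ih hx.2 _)

/-- Reduction creates the substitution at the hole, the machine at the head of the environment. It
crosses the stacks by `appL` and the evaluated codes by `appR`, both read from right to left, and
stops at the first entry that is not a pair; freshness of `x` gives the side conditions. -/
theorem FrameInv.frameCtx_es {F : Frame} {L : Env} (hF : FrameInv F L) {x : Name} {u : Code}
    (hx : x ∉ envScope L) (hu : ∀ y ∈ u.fv, y ∈ envScope L) (t : Term) :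
    StructEq ((frameCtx F L).plug (.es t (u.toTerm (envScope L))))
      ((frameCtx F (.sub x u :: L)).plug t) := by
  induction hF generalizing t with
  | nil =>
    rw [FrameInv.nil.frameCtx_sub .nil, Ctx.comp_plug]
    exact .refl _
  | @pair w π F L _ _ ho hπ hF ih =>
    have hw : x ∉ w.fv := fun h => hx (lookupLive_opened (ho x h)).1
    rw [hF.frameCtx_pair, (hF.add_sub hx hu).frameCtx_pair, Ctx.comp_plug, Ctx.comp_plug,
      Ctx.comp_plug, Ctx.comp_plug, envScope]
    refine StructEq.trans ?_ (ih hx hu _)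
    refine StructEq.plug _ (StructEq.trans ?_ (stackCtx_es (fun v hv h => hx (hπ v hv x h)) _ _ _))
    simp only [Ctx.plug, Code.toTerm_cons _ hw]
    exact (StructEq.root (.appR _ _ _)).symm.plug _
  | sub hF hu' h _ =>
    rw [(FrameInv.sub hF hu' h).frameCtx_sub hF, Ctx.comp_plug]
    exact .refl _
  | abs h _ =>
    rw [h.abs.frameCtx_sub (.abs _ _), Ctx.comp_plug]
    exact .refl _

theorem GcSteps.plug (C : Ctx) {t u : Term} (h : GcSteps t u) : GcSteps (C.plug t) (C.plug u) := by
  induction h with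
  | refl => exact .refl
  | tail _ h ih => exact ih.tail (h.plug C)

theorem GcSteps.structEq {t u : Term} (h : GcSteps t u) : StructEq t u := by
  induction h with
  | refl => exact .refl _
  | tail _ h ih =>
    obtain ⟨C, a, b, h, rfl, rfl⟩ := h
    exact ih.trans ((StructEq.root (.gc h)).plug C)

/-- Every variable of the evaluated code belongs to an open scope, so each substitution between the
hole and the abstraction of `x` binds nothing and is collected, innermost first. -/
theorem FrameInv.gcSteps {x : Name} {F : Frame} {L : Env} (hF : FrameInv (.abs x :: F) L)
    {t : Code} (ht : ∀ y ∈ t.fv, lookupLive L y = .opened) :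
    GcSteps ((frameCtx (.abs x :: F) L).plug (t.toTerm (envScope L)))
      ((frameCtx F (StrongMAM.closeScope L)).plug
        ((Code.lam x t).toTerm (envScope (StrongMAM.closeScope L)))) := by
  generalize hF' : FrameEntry.abs x :: F = F' at hF
  induction hF with
  | nil | pair => cases hF'
  | @sub F' y u L hF _ h ih =>
    have hne : ∀ z ∈ t.fv, z ≠ y := by
      rintro z hz rfl
      simpa [lookupLive] using ht z hz
    rw [h.frameCtx_sub hF, Ctx.comp_plug, envScope, Code.toTerm_cons _ fun h => hne y h rfl]
    refine .trans (GcSteps.plug _ (.single (.root (.mk _ _)))) ?_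
    subst hF'
    refine ih (fun z hz => ?_) rfl
    simpa [lookupLive, hne z hz] using ht z hz
  | abs h _ =>
    cases hF'
    rw [frameCtx_abs, Ctx.comp_plug]
    exact .refl

/-! ### Projection of the transitions -/

theorem State.Inv.mul {ρ : State → Code → Code} (hρ : IsFreshRenaming ρ) {s s' : State}
    (h : s.Inv) (hs : Step ρ .m s s') :
    ∃ u, LOStep .m (decode s) u ∧ StructEq u (decode s') := by
  have h' := h.step hρ hs
  rw [h.decode_eq, h'.decode_eq]
  cases hs with
  | m F x t u π E =>
    have hx : x ∉ envScope (live E) := by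
      intro hx
      exact (List.nodup_append.1 h.nodup).2.2 x hx x (by simp [activeBinders, Code.binders]) rfl
    have hπ := h.stack
    simp only [List.mem_cons, forall_eq_or_imp] at hπ
    simp only [stackCtx_cons_plug]
    refine ⟨_, ⟨_, loAt_iff.1 (LOAt.frameCtx h.frame
      (LOAt.stackCtx (.mul rfl) (fun _ => rfl) _ _))⟩, ?_⟩
    refine StructEq.trans ?_ (h.frame.frameCtx_es hx hπ.1 _)
    exact (stackCtx_es (fun v hv h => hx (hπ.2 v hv x h)) _ _ _).plug _

theorem State.Inv.exp {ρ : State → Code → Code} (hρ : IsFreshRenaming ρ) {s s' : State}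
    (h : s.Inv) (hs : Step ρ .e s s') :
    LOStep .e (decode s) (decode s') ∧
      ∃ x t, s.code = .var x ∧ lookup s.env x = .code t ∧
        IsLORedex ((stateCtx s).toCtx []) (decode s) ∧
        ExpAt ((stateCtx s).toCtx []) (t.toTerm ((stateCtx s).scope []))
          (decode s) (decode s') := by
  have h' := h.step hρ hs
  rw [h.decode_eq, h'.decode_eq, h.toCtx_stateCtx, h.scope_stateCtx]
  cases hs with
  | e F x t π E hx =>
    have hα := (hρ ⟨.eval, F, .var x, π, E⟩ t).1.toTerm_eq (envScope (live E))
    simp only [hα]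
    have hl := (h.frame.lookupLive_code h.nodup_envScope hx).2
    have hs := LOAt.frameCtx h.frame
      (LOAt.stackCtx (.var hl) (fun _ => rfl) (envScope (live E)) π)
    rw [Ctx.comp_hole] at hs
    obtain ⟨h1, v, h2⟩ := loAt_iff.1 hs
    refine ⟨⟨_, h1, v, h2⟩, x, t, rfl, hx, h1, ?_⟩
    -- `LOAt` leaves the duplicated term `v` existential; injectivity of plugging recovers it from
    -- the contractum.
    have heq {C : Ctx} {v t r : Term} (h : ExpAt C v t r) : r = C.plug v := by
      cases h
      rfl
    have := heq h2
    rw [Ctx.comp_plug] at this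
    obtain rfl := Ctx.plug_injective _ (Ctx.plug_injective _ this)
    exact h2

theorem State.Inv.gc {ρ : State → Code → Code} (hρ : IsFreshRenaming ρ) {s s' : State}
    (h : s.Inv) (hs : Step ρ .c4 s s') : GcSteps (decode s) (decode s') := by
  have h' := h.step hρ hs
  rw [h.decode_eq, h'.decode_eq]
  cases hs with
  | c4 F x t E => exact h.frame.gcSteps (h.back rfl).2.2

theorem State.Inv.decode_eq_of_step {ρ : State → Code → Code} (hρ : IsFreshRenaming ρ)
    {s s' : State} (h : s.Inv) {τ : Trans} (hτ : τ ∈ ({.c1, .c2, .c3, .c5, .c6} : Set Trans))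
    (hs : Step ρ τ s s') : decode s = decode s' := by
  have h' := h.step hρ hs
  rw [h.decode_eq, h'.decode_eq]
  cases hs with
  | c1 F t u π E => simp only [stackCtx_cons_plug]; rfl
  | c2 F x t E => simp only [live, frameCtx_abs, Ctx.comp_plug]; rfl
  | c3 => rfl
  | c5 F t u π E =>
    simp only [h'.frame.frameCtx_pair, Ctx.comp_plug]
    rfl
  | c6 F t u π E =>
    simp only [h.frame.frameCtx_pair, Ctx.comp_plug, stackCtx_cons_plug]
    rfl
  | m | e | c4 => simp at hτ

theorem State.Inv.structEq_of_commutative {ρ : State → Code → Code} (hρ : IsFreshRenaming ρ)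
    {s s' : State} (h : s.Inv) (hs : (strongMAM ρ).step .commutative s s') :
    StructEq (decode s) (decode s') := by
  obtain ⟨τ, hτ, hs⟩ := hs
  cases τ with
  | m | e => cases hτ
  | c4 => exact (h.gc hρ hs).structEq
  | c1 | c2 | c3 | c5 | c6 => exact .of_eq (h.decode_eq_of_step hρ (by simp) hs)

theorem State.Inv.principal {ρ : State → Code → Code} (hρ : IsFreshRenaming ρ) {k : Kind}
    {s s' : State} (h : s.Inv) (hs : (strongMAM ρ).step (.principal k) s s') :
    ∃ u, LOStep k (decode s) u ∧ StructEq u (decode s') := by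
  obtain ⟨τ, hτ, hs⟩ := hs
  cases τ with
  | m =>
    cases hτ
    exact h.mul hρ hs
  | e =>
    cases hτ
    exact ⟨_, (h.exp hρ hs).1, .refl _⟩
  | c1 | c2 | c3 | c4 | c5 | c6 => cases hτ

/-! ## The machine -/

theorem Step.deterministic {ρ : State → Code → Code} {τ τ' : Trans} {s s' s'' : State}
    (h : Step ρ τ s s') (h' : Step ρ τ' s s'') : τ = τ' ∧ s' = s'' := by
  cases h with
  | e F x t π E hx =>
    cases h' with
    | e _ _ t' _ _ hx' =>
      obtain rfl : t = t' := by simpa [hx] using hx'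
      exact ⟨rfl, rfl⟩
    | c3 _ _ _ _ hx' => simp [hx] at hx'
  | c3 F x π E hx =>
    cases h' with
    | e _ _ t' _ _ hx' => simp [hx] at hx'
    | c3 => exact ⟨rfl, rfl⟩
  | c1 | m | c2 | c4 | c5 | c6 =>
    cases h'
    exact ⟨rfl, rfl⟩

/-- Evaluation never blocks, because the free names of the code are in scope and look up cannot
fail. Backtracking blocks only with empty stack and frame, on a code that is normal. -/
theorem State.Inv.not_loStep_of_final {ρ : State → Code → Code} {s : State} (h : s.Inv)
    (hf : (strongMAM ρ).Final s) : loStep (fun _ => none) (decode s) = none := by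
  have hf' {τ s'} (hs : Step ρ τ s s') : False := hf τ.label s' ⟨τ, rfl, hs⟩
  have hd := h.decode_eq
  obtain ⟨φ, F, t, π, E⟩ := s
  cases φ with
  | eval =>
    exfalso
    cases t with
    | app => exact hf' (.c1 ..)
    | lam =>
      cases π with
      | nil => exact hf' (.c2 ..)
      | cons => exact hf' (.m ..)
    | var x =>
      have hx := lookupLive_ne_undefined (h.code x (by simp [Code.fv]))
      cases hl : lookup E x with
      | undefined => exact hx hl
      | code => exact hf' (.e _ _ _ _ _ hl)
      | opened => exact hf' (.c3 _ _ _ _ hl)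
  | back =>
    cases π with
    | cons => exact (hf' (.c6 ..)).elim
    | nil =>
      cases F with
      | nil =>
        rw [hd]
        obtain ⟨hn, -, ho⟩ := h.back rfl
        exact h.frame.loStep_eq_none
          (hn.loStep_toTerm fun x hx => (lookupLive_opened (ho x hx)).2)
      | cons e F =>
        cases e with
        | pair => exact (hf' (.c5 ..)).elim
        | abs => exact (hf' (.c4 ..)).elim

/-- A bound on the length of the evaluations and backtracking phases of a code. -/
def Code.weight : Code → ℕ
  | var _ => 1
  | lam _ t => t.weight + 2
  | app t u => t.weight + u.weight + 3

/-- The sum of the weights of the codes of a stack. -/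
def stackWeight (π : Stack) : ℕ := (π.map fun t => t.weight + 2).sum

/-- The weight of what is still to be evaluated in a frame. -/
def frameWeight : Frame → ℕ
  | [] => 0
  | .pair _ π :: F => stackWeight π + 1 + frameWeight F
  | .abs _ :: F => 1 + frameWeight F

/-- A bound on the number of commutative transitions before a principal one. -/
def State.weight : State → ℕ
  | ⟨.eval, F, t, π, _⟩ => t.weight + stackWeight π + frameWeight F
  | ⟨.back, F, _, π, _⟩ => stackWeight π + frameWeight F

/-- The constants leave a surplus for every visit: an argument on the stack costs two more than its
code, one being spent by `c6` and one by `c5`. The environment does not count, since only `e` reads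
a code back from it. -/
theorem State.weight_lt {ρ : State → Code → Code} {s s' : State}
    (hs : (strongMAM ρ).step .commutative s s') : s'.weight < s.weight := by
  obtain ⟨τ, hτ, hs⟩ := hs
  cases hs with
  | m | e => cases hτ
  | c1 | c2 | c3 | c4 | c5 | c6 =>
    simp only [weight, Code.weight, stackWeight, frameWeight, List.map_cons, List.sum_cons,
      List.map_nil, List.sum_nil]
    omega

theorem State.Inv.of_path {ρ : State → Code → Code} (hρ : IsFreshRenaming ρ) {s s' : State}
    {l : List Label} (h : s.Inv) (hp : Path (strongMAM ρ).step s l s') : s'.Inv := by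
  induction hp with
  | nil => exact h
  | cons hs _ ih =>
    obtain ⟨τ, -, hs⟩ := hs
    exact ih (h.step hρ hs)

theorem State.inv_of_reachable {ρ : State → Code → Code} (hρ : IsFreshRenaming ρ) {s : State}
    (h : (strongMAM ρ).Reachable s) : s.Inv := by
  obtain ⟨_, ⟨t, ht, rfl⟩, l, hp⟩ := h
  exact (State.inv_initial ht).of_path hρ hp

theorem Path.append {L S : Type} {R : L → S → S → Prop} {s s' s'' : S} {l l' : List L}
    (h : Path R s l s') (h' : Path R s' l' s'') : Path R s (l ++ l') s'' := by
  induction h with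
  | nil => exact h'
  | cons h _ ih => exact .cons h (ih h')

theorem Machine.Reachable.append {S : Type} {M : Machine S} {s s' : S} {l : List Label}
    (h : M.Reachable s) (h' : Path M.step s l s') : M.Reachable s' := by
  obtain ⟨s₀, h₀, l₀, hp⟩ := h
  exact ⟨s₀, h₀, _, hp.append h'⟩

/-! ## Properties of distilleries -/

section Distillery

variable {S : Type} {M : Machine S} {strat : Kind → Term → Term → Prop}
  {eqv : Term → Term → Prop} {decode : S → Term}

theorem IsDistillery.simulates (h : IsDistillery M strat eqv decode) :
    Simulates M strat eqv decode := by
  -- The derivation starts from any term equivalent to the decoding, because after one principal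
  -- transition the two agree only up to the equivalence.
  have main : ∀ s l s', Path M.step s l s' → M.Reachable s → ∀ t, eqv t (decode s) →
      ∃ d u, Path strat t d u ∧ eqv u (decode s') ∧ ∀ k, l.count (.principal k) = d.count k := by
    intro s l s' hp
    induction hp with
    | nil s => exact fun _ t ht => ⟨[], t, .nil t, ht, by simp⟩
    | @cons a l s s' s'' hs hp ih =>
      intro hr t ht
      have hr' := hr.append (.cons hs (.nil _))
      cases a with
      | commutative =>
        obtain ⟨d, u, h1, h2, h3⟩ := ih hr' t (h.equivalence.trans ht (h.distillation _ _ hr hs))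
        exact ⟨d, u, h1, h2, fun k => by simp [h3]⟩
      | principal k =>
        obtain ⟨w, hw, hw'⟩ := h.projection _ _ _ hr hs
        obtain ⟨r, hr1, hr2⟩ := h.strong_bisimulation _ _ _ _ ht hw
        obtain ⟨d, u, h1, h2, h3⟩ := ih hr' r (h.equivalence.trans hr2 hw')
        exact ⟨k :: d, u, .cons hr1 h1, h2, fun k' => by simp [List.count_cons, h3]⟩
  intro s hs l s' hp
  exact main s l s' hp ⟨s, hs, [], .nil s⟩ _ (h.equivalence.refl _)

/-- If no principal transition were reached, commutative ones would continue forever: they preserve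
the decoding up to the equivalence, so by bisimulation it stays reducible and progress excludes a
final state. -/
theorem IsReflective.exists_principal (h : IsDistillery M strat eqv decode)
    (h' : IsReflective M strat decode) {s : S} (hs : M.Reachable s) {k : Kind} {u : Term}
    (hu : strat k (decode s) u) :
    ∃ l s₁ k' s', Path M.step s l s₁ ∧ (∀ k, l.count (.principal k) = 0) ∧
      eqv (decode s) (decode s₁) ∧ M.step (.principal k') s₁ s' := by
  by_contra hcon
  have next : ∀ x : {s' : S // ∃ l, Path M.step s l s' ∧ (∀ k, l.count (.principal k) = 0) ∧
      eqv (decode s) (decode s')}, ∃ y : {s' : S // ∃ l, Path M.step s l s' ∧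
        (∀ k, l.count (.principal k) = 0) ∧ eqv (decode s) (decode s')},
      M.step .commutative x.1 y.1 := by
    rintro ⟨x, l, hp, hl, he⟩
    have hx := hs.append hp
    by_cases hfin : M.Final x
    · obtain ⟨r, hr, -⟩ := h.strong_bisimulation _ _ _ _ (h.equivalence.symm he) hu
      exact absurd hr (h'.progress x hx hfin _ _)
    · simp only [Machine.Final, not_forall, not_not] at hfin
      obtain ⟨a, y, hy⟩ := hfin
      cases a with
      | principal k' => exact absurd ⟨l, x, k', y, hp, hl, he, hy⟩ hcon
      | commutative =>
        refine ⟨⟨y, l ++ [.commutative], hp.append (.cons hy (.nil y)), ?_,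
          h.equivalence.trans he (h.distillation _ _ hx hy)⟩, hy⟩
        simp [hl]
  -- Iterating the chosen successor gives the infinite commutative sequence that termination
  -- forbids.
  choose f hf using next
  let x₀ : {s' : S // ∃ l, Path M.step s l s' ∧ (∀ k, l.count (.principal k) = 0) ∧
      eqv (decode s) (decode s')} := ⟨s, [], .nil s, by simp, h.equivalence.refl _⟩
  refine h'.termination s hs ⟨fun n => (f^[n] x₀).1, rfl, fun n => ?_⟩
  simp only [Function.iterate_succ_apply']
  exact hf _

theorem IsReflective.reverseSimulates (h : IsDistillery M strat eqv decode)
    (h' : IsReflective M strat decode) : ReverseSimulates M strat eqv decode := by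
  have main : ∀ t d u, Path strat t d u → ∀ s, M.Reachable s → eqv t (decode s) →
      ∃ l s', Path M.step s l s' ∧ eqv u (decode s') ∧
        ∀ k, l.count (.principal k) = d.count k := by
    intro t d u hp
    induction hp with
    | nil t => exact fun s _ ht => ⟨[], s, .nil s, ht, by simp⟩
    | @cons k d t t' u ht _ ih =>
      intro s hs hts
      obtain ⟨w, hw, hwt⟩ := h.strong_bisimulation _ _ _ _ (h.equivalence.symm hts) ht
      obtain ⟨l, s₁, k', s₂, hp, hl, he, hstep⟩ := h'.exists_principal h hs hw
      have hs₁ := hs.append hp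
      obtain ⟨v, hv, hv'⟩ := h.projection _ _ _ hs₁ hstep
      obtain ⟨v', hv1, hv2⟩ := h.strong_bisimulation _ _ _ _ he hv
      -- The machine chooses the kind of its principal transition; pulled back along the
      -- equivalence, its step must be the given one.
      obtain ⟨rfl, rfl⟩ := h.strategy_deterministic _ _ _ _ _ hw hv1
      obtain ⟨l', s', hp', hu, hc⟩ := ih s₂ (hs₁.append (.cons hstep (.nil _)))
        (h.equivalence.trans (h.equivalence.symm hwt) (h.equivalence.trans hv2 hv'))
      exact ⟨l ++ .principal k :: l', s', hp.append (.cons hstep hp'), hu,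
        fun k' => by simp [List.count_cons, hl, hc]⟩
  intro s hs d t hp
  exact main _ d t hp s ⟨s, hs, [], .nil s⟩ (h.equivalence.refl _)

end Distillery

theorem strongMAM_isDistillery {ρ : State → Code → Code} (hρ : IsFreshRenaming ρ) :
    IsDistillery (strongMAM ρ) LOStep StructEq decode where
  machine_deterministic := by
    rintro _ _ s s' s'' ⟨τ, rfl, h⟩ ⟨τ', rfl, h'⟩
    obtain ⟨rfl, rfl⟩ := h.deterministic h'
    exact ⟨rfl, rfl⟩
  initial_bijection := by
    refine ⟨fun t => ⟨.eval, [], t, [], []⟩, ⟨fun t ht => ⟨t, ht, rfl⟩, ?_, ?_⟩, ?_⟩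
    · intro t _ u _ h
      exact (State.mk.injEq .. ▸ h).2.2.1
    · rintro _ ⟨t, ht, rfl⟩
      exact ⟨t, ht, rfl⟩
    · intro t ht
      rw [(State.inv_initial ht).decode_eq]
      simp [frameCtx, live, decodeLive_nil, stackCtx, decodeStack, NCtx.toCtx, Ctx.plug, envScope]
  initial_complete := by
    intro t ht hcl
    obtain ⟨c, hc, hfv, hnd, -⟩ := Code.exists_toTerm_eq ht (Γ := []) hcl .nil (N := 0) (by simp)
    have hfv' : c.fv = ∅ := Finset.eq_empty_of_forall_notMem fun x hx => by simpa using hfv x hx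
    have hi : c.IsInitial := ⟨hfv', hnd, by simp [hfv']⟩
    refine ⟨_, ⟨c, hi, rfl⟩, ?_⟩
    rw [(State.inv_initial hi).decode_eq]
    simp [frameCtx, live, decodeLive_nil, stackCtx, decodeStack, NCtx.toCtx, Ctx.plug, envScope, hc]
  strategy_reduction := fun _ _ _ ⟨C, _, h⟩ => ⟨C, h⟩
  strategy_deterministic := fun _ _ _ _ _ h h' => h.deterministic h'
  equivalence := ⟨.refl, .symm, .trans⟩
  strong_bisimulation := fun _ _ _ _ h h' => h'.bisim h
  projection := fun _ _ _ hs h => (State.inv_of_reachable hρ hs).principal hρ h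
  distillation := fun _ _ hs h => (State.inv_of_reachable hρ hs).structEq_of_commutative hρ h

theorem strongMAM_isReflective {ρ : State → Code → Code} (hρ : IsFreshRenaming ρ) :
    IsReflective (strongMAM ρ) LOStep decode where
  termination := by
    rintro s - ⟨f, -, hf⟩
    exact not_strictAnti_of_wellFoundedLT (fun n => (f n).weight)
      (strictAnti_nat_of_succ_lt fun n => State.weight_lt (hf n))
  progress := by
    intro s hs hfin k u h
    rw [loStep_iff, (State.inv_of_reachable hρ hs).not_loStep_of_final hfin] at h
    cases h

end StrongMAM

open StrongMAM in
theorem mainTheorem1 (ρ : State → Code → Code) (hρ : IsFreshRenaming ρ) :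
    IsDistillery (strongMAM ρ) LOStep StructEq decode ∧
    IsReflective (strongMAM ρ) LOStep decode ∧
    (∀ s, (strongMAM ρ).Reachable s → Compatible s.frame s.env) ∧
    (∀ s s', (strongMAM ρ).Reachable s →
      (Step ρ .m s s' → ∃ u, LOStep .m (decode s) u ∧ StructEq u (decode s')) ∧
      (Step ρ .e s s' → LOStep .e (decode s) (decode s') ∧
        ∃ x t, s.code = .var x ∧ lookup s.env x = .code t ∧
          IsLORedex ((stateCtx s).toCtx []) (decode s) ∧
          ExpAt ((stateCtx s).toCtx []) (t.toTerm ((stateCtx s).scope []))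
            (decode s) (decode s')) ∧
      (Step ρ .c4 s s' → GcSteps (decode s) (decode s')) ∧
      (∀ τ ∈ ({.c1, .c2, .c3, .c5, .c6} : Set Trans), Step ρ τ s s' → decode s = decode s')) ∧
    Simulates (strongMAM ρ) LOStep StructEq decode ∧
    ReverseSimulates (strongMAM ρ) LOStep StructEq decode := by
  have hd := strongMAM_isDistillery hρ
  have hr := strongMAM_isReflective hρ
  refine ⟨hd, hr, fun s hs => (State.inv_of_reachable hρ hs).compatible, fun s s' hs => ?_,
    hd.simulates, hr.reverseSimulates hd⟩
  have h := State.inv_of_reachable hρ hs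
  exact ⟨h.mul hρ, h.exp hρ, h.gc hρ, fun τ hτ => h.decode_eq_of_step hρ hτ⟩
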